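/- **Setting.** A state $\omega\in\Omega$ is drawn from a prior $D$. An experiment is a map $\sigma:\Omega\to\Delta(S)$ into distributions over signals (the signal space contains the states and encodes pairs of signals); $\sigma|\mu$ denotes the distribution of the Bayesian posterior that $\sigma$ induces from the belief $\mu$, and $\sigma^{F}$ is the experiment $\omega\mapsto\omega$ that reveals full information. An agent has a private type $\theta\in\Theta=[\underline\theta,\overline\theta]$, $0\le\underline\theta<\overline\theta$, with distribution function $F$ and density $f$, positive on $(\underline\theta,\overline\theta)$, and values a belief $\mu$ at $V(\mu,\theta)$, which is monotone in the Blackwell order: for every type and every belief, more informative experiments give a weakly higher expected valuation. After receiving a signal from the data broker the agent, with belief $\mu$, may conduct any experiment $\hat\sigma$ in a set $\hat\Sigma$ at cost $C(\hat\sigma,\mu)\ge 0$; $\hat\Sigma$ contains an uninformative experiment of cost $0$. Put $$V(\mu,\hat\Sigma,\theta)=\max_{\hat\sigma\in\hat\Sigma}\ \mathbb E_{\hat\mu\sim\hat\sigma|\mu}[V(\hat\mu,\theta)]-C(\hat\sigma,\mu),$$ where expectations are assumed to exist and the maximum to be attained (by a choice depending measurably on $\mu$). A mechanism $(\pi,p)$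 assigns to each type $\theta$ a distribution $\pi(\theta)$ over experiments and a payment $p(\theta)\in\mathbb R$. Let $U(\theta;\theta')=\mathbb E_{\sigma\sim\pi(\theta')}\mathbb E_{\mu\sim\sigma|D}[V(\mu,\hat\Sigma,\theta)]-p(\theta')$ and $U(\theta)=U(\theta;\theta)$. The mechanism is incentive compatible if $U(\theta)\ge U(\theta;\theta')$ for all $\theta,\theta'\in\Theta$, and individually rational if $U(\theta)\ge V(D,\hat\Sigma,\theta)$ for all $\theta\in\Theta$. It is optimal if it maximizes $\mathbb E_{\theta\sim F}[p(\theta)]$ among all incentive compatible and individually rational mechanisms (for which this expectation exists). **Assumptions.** 1. (Convex separable valuation.) $V(\mu,\theta)=v(\mu)\,\theta$ with $v$ convex. 2. (Sequential learning.) For $\hat\sigma\in\hat\Sigma$ and any (measurable) $\kappa:S\to\hat\Sigma$, the experiment $\hat\sigma\circ\kappa$ that conducts $\hat\sigma$ and, after its signal $s$, conducts $\kappa(s)$ belongs to $\hat\Sigma$, and for every belief $\mu$ $$C(\hat\sigma\circ\kappa,\mu)\le C(\hat\sigma,\mu)+\int_\Omega\int_S C(\kappa(s),\hat\mu_{\hat\sigma,s,\mu})\,d\hat\sigma(s|\omega)\,d\mu(\omega),$$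 where $\hat\mu_{\hat\sigma,s,\mu}$ is the posterior after the signal $s$ of $\hat\sigma$ from the belief $\mu$. 3. (Regularity.) The virtual value $\phi(\theta)=\theta-\frac{1-F(\theta)}{f(\theta)}$ is non-decreasing. Let $\theta^*=\inf\{\theta:\phi(\theta)\ge 0\}$ be the monopoly type. For each $\theta\in[\underline\theta,\theta^*)$ let $\hat\sigma_\theta$ be a maximizer over $\hat\sigma\in\hat\Sigma$ of $$\mathbb E_{\mu\sim\hat\sigma|D}[V(\mu,\theta)]-C(\hat\sigma,D)$$ that has the largest cost $C(\hat\sigma,D)$ among all maximizers (such a maximizer is taken to exist). **Theorem.** There is an optimal mechanism, with interim utility $U$, such that * every type $\theta\in[\theta^*,\overline\theta]$ receives the fully revealing experiment $\sigma^{F}$; * every type $\theta\in[\underline\theta,\theta^*)$ receives the experiment $\hat\sigma_\theta$; * $U(\underline\theta)=V(D,\hat\Sigma,\underline\theta)$, and moreover $U(\theta)=V(D,\hat\Sigma,\theta)$ for every $\theta\in[\underline\theta,\theta^*)$. -/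

import Mathlib

open MeasureTheory ProbabilityTheory Set
open scoped NNReal

namespace InfoSale

noncomputable section

/-- Beliefs `Δ(Ω)` about the state. -/
abbrev Belief (Ω : Type*) [MeasurableSpace Ω] := ProbabilityMeasure Ω

/-- An experiment: in state `ω` it draws a signal in `S` from the law `kernel ω`. -/
structure Experiment (Ω S : Type*) [MeasurableSpace Ω] [MeasurableSpace S] where
  kernel : Kernel Ω S
  markov : IsMarkovKernel kernel

instance {Ω S : Type*} [MeasurableSpace Ω] [MeasurableSpace S] (σ : Experiment Ω S) :
    IsMarkovKernel σ.kernel := σ.markov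

/-- A measurable family of experiments indexed by `X`, that is, a mapping `x ↦ κ(x)` from `X` to
experiments whose signal laws depend measurably on the index and the state. -/
structure Plan (Ω X S : Type*) [MeasurableSpace Ω] [MeasurableSpace X] [MeasurableSpace S] where
  kernel : Kernel (Ω × X) S
  markov : IsMarkovKernel kernel

instance {Ω X S : Type*} [MeasurableSpace Ω] [MeasurableSpace X] [MeasurableSpace S]
    (κ : Plan Ω X S) : IsMarkovKernel κ.kernel := κ.markov

/-- The experiment `κ(x)` that the family `κ` assigns to the index `x`. -/
def Plan.choice {Ω X S : Type*} [MeasurableSpace Ω] [MeasurableSpace X] [MeasurableSpace S]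
    (κ : Plan Ω X S) (x : X) : Experiment Ω S where
  kernel := κ.kernel.comap (fun ω => (ω, x)) (measurable_id.prodMk measurable_const)
  markov := inferInstance

section Posterior

variable {Ω S : Type*} [MeasurableSpace Ω] [StandardBorelSpace Ω] [Nonempty Ω]
  [MeasurableSpace S]

/-- The law of the signal of `σ` when the state is distributed according to `μ`. -/
def Experiment.signalLaw (σ : Experiment Ω S) (μ : Belief Ω) : Measure S :=
  (μ : Measure Ω).bind σ.kernel

/-- The Bayesian posterior after the signal `s` of `σ`, starting from the belief `μ`. -/
def Experiment.posteriorBelief (σ : Experiment Ω S) (μ : Belief Ω) (s : S) : Belief Ω :=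
  ⟨posterior σ.kernel (μ : Measure Ω) s, inferInstance⟩

/-- `σ|μ`: the distribution over posteriors that `σ` induces when the current belief is `μ`. -/
def Experiment.posteriorLaw (σ : Experiment Ω S) (μ : Belief Ω) : Measure (Belief Ω) :=
  (σ.signalLaw μ).map (σ.posteriorBelief μ)

/-- `σ'` is a garbling of `σ`, that is, `σ` is Blackwell more informative than `σ'`. -/
def Experiment.IsGarblingOf (σ' σ : Experiment Ω S) : Prop :=
  ∃ η : Kernel S S, IsMarkovKernel η ∧ σ'.kernel = η.comp σ.kernel

/-- The measurable structure on experiments that is used for distributions over experiments: the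
smallest one for which, at every belief, the induced distribution over posteriors depends
measurably on the experiment. -/
instance : MeasurableSpace (Experiment Ω S) :=
  ⨆ μ : Belief Ω, MeasurableSpace.comap (fun σ : Experiment Ω S => σ.posteriorLaw μ) inferInstance

end Posterior

/-- The primitives of the model: states `Ω` and signals `S`, the prior, the agent's valuation
`V(μ, θ)`, her experiments `feasible` with their costs, and the density of her type on `[lo, hi]`.

The signal space is rich enough to contain the states (`reveal`) and to encode pairs of signals
(`pair`). `beliefs` is the set of beliefs at which the valuation is considered; it may be all of
`Δ(Ω)`, and a smaller set allows for a `V` that is finite only at some beliefs, such as minus the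
variance when `Ω = ℝ`. -/
structure Environment (Ω S : Type*) [MeasurableSpace Ω] [MeasurableSpace S] where
  prior : Belief Ω
  beliefs : Set (Belief Ω)
  valuation : Belief Ω → ℝ → ℝ
  reveal : Ω → S
  reveal_embedding : MeasurableEmbedding reveal
  pair : S × S → S
  pair_embedding : MeasurableEmbedding pair
  feasible : Set (Experiment Ω S)
  null : Experiment Ω S
  cost : Experiment Ω S → Belief Ω → ℝ
  lo : ℝ
  hi : ℝ
  density : ℝ → ℝ

/-- A (direct) mechanism: to each type, a distribution over experiments and a payment. -/
structure Mechanism (Ω S : Type*) [MeasurableSpace Ω] [StandardBorelSpace Ω] [Nonempty Ω]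
    [MeasurableSpace S] where
  alloc : ℝ → Measure (Experiment Ω S)
  isProbabilityMeasure_alloc : ∀ θ, IsProbabilityMeasure (alloc θ)
  payment : ℝ → ℝ

/-- The mechanism that gives type `θ` the experiment `α θ` for sure, at the price `p θ`. -/
def Mechanism.deterministic {Ω S : Type*} [MeasurableSpace Ω] [StandardBorelSpace Ω] [Nonempty Ω]
    [MeasurableSpace S] (α : ℝ → Experiment Ω S) (p : ℝ → ℝ) : Mechanism Ω S where
  alloc θ := Measure.dirac (α θ)
  isProbabilityMeasure_alloc _ := inferInstance
  payment := p

namespace Environment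

section Basic

variable {Ω S : Type*} [MeasurableSpace Ω] [MeasurableSpace S] (E : Environment Ω S)

/-- The type space `Θ`. -/
def types : Set ℝ := Icc E.lo E.hi

/-- The experiment `ω ↦ ω` that reveals full information. -/
def full : Experiment Ω S where
  kernel := Kernel.deterministic E.reveal E.reveal_embedding.measurable
  markov := inferInstance

/-- `σ ∘ κ`: conduct `σ`, and after its signal `s` continue with the experiment `κ(s)`. Both
signals are observed. -/
def seq (σ : Experiment Ω S) (κ : Plan Ω S S) : Experiment Ω S where
  kernel := (σ.kernel.compProd κ.kernel).map E.pair
  markov := Kernel.IsMarkovKernel.map _ E.pair_embedding.measurable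

/-- The distribution function `F` of the type. -/
def cdf (θ : ℝ) : ℝ := ∫ z in E.lo..θ, E.density z

/-- The virtual value `φ`. -/
def virtualValue (θ : ℝ) : ℝ := θ - (1 - E.cdf θ) / E.density θ

/-- The monopoly type `θ*`. The infimum is taken in the interior of the type space, where the
density is positive and the virtual value makes sense. -/
def monopolyType : ℝ := sInf {θ | θ ∈ Ioo E.lo E.hi ∧ 0 ≤ E.virtualValue θ}

/-- The type distribution is regular. -/
def Regular : Prop := MonotoneOn E.virtualValue (Ioo E.lo E.hi)

/-- The type has a density on a nondegenerate interval `[lo, hi]` of nonnegative numbers, positive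
in the interior. -/
structure HasTypeDensity : Prop where
  lo_nonneg : 0 ≤ E.lo
  lo_lt_hi : E.lo < E.hi
  density_pos : ∀ θ ∈ Ioo E.lo E.hi, 0 < E.density θ
  density_integrable : IntervalIntegrable E.density volume E.lo E.hi
  density_integral : ∫ θ in E.lo..E.hi, E.density θ = 1

/-- The valuation is separable, `V(μ, θ) = v(μ) θ`, with a convex function `v`. -/
def ConvexSeparable : Prop :=
  ∃ v : Belief Ω → ℝ,
    (∀ μ ∈ E.beliefs, ∀ θ ∈ E.types, E.valuation μ θ = v μ * θ) ∧
    ∀ μ ∈ E.beliefs, ∀ ν ∈ E.beliefs, ∀ a b : ℝ≥0, a + b = 1 → ∀ ρ : Belief Ω,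
      (ρ : Measure Ω) = a • (μ : Measure Ω) + b • (ν : Measure Ω) →
        ρ ∈ E.beliefs ∧ v ρ ≤ a * v μ + b * v ν

end Basic

variable {Ω S : Type*} [MeasurableSpace Ω] [StandardBorelSpace Ω] [Nonempty Ω]
  [MeasurableSpace S] (E : Environment Ω S)

/-- The payoff of type `θ` with belief `μ` who conducts `σ`: expected valuation of the posterior
minus the cost. -/
def payoff (σ : Experiment Ω S) (μ : Belief Ω) (θ : ℝ) : ℝ :=
  (∫ ν, E.valuation ν θ ∂(σ.posteriorLaw μ)) - E.cost σ μ

/-- `σ` is an optimal feasible experiment for type `θ` with belief `μ`. -/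
def IsOptimalChoice (σ : Experiment Ω S) (μ : Belief Ω) (θ : ℝ) : Prop :=
  σ ∈ E.feasible ∧ ∀ τ ∈ E.feasible, E.payoff τ μ θ ≤ E.payoff σ μ θ

/-- `σ` is an optimal feasible experiment for type `θ` with belief `μ`, where ties are broken by
maximizing the cost. -/
def IsTieBrokenChoice (σ : Experiment Ω S) (μ : Belief Ω) (θ : ℝ) : Prop :=
  E.IsOptimalChoice σ μ θ ∧ ∀ τ, E.IsOptimalChoice τ μ θ → E.cost τ μ ≤ E.cost σ μ

/-- `V(μ, Σ̂, θ)`: the value of the belief `μ` for type `θ` who can conduct her own experiments. -/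
def value (μ : Belief Ω) (θ : ℝ) : ℝ :=
  sSup ((fun σ => E.payoff σ μ θ) '' E.feasible)

/-- The standing assumptions of the model. -/
structure Standing : Prop where
  /-- The set of beliefs contains the prior and is closed under Bayesian updating. -/
  prior_mem : E.prior ∈ E.beliefs
  posterior_mem : ∀ μ ∈ E.beliefs, ∀ σ : Experiment Ω S, ∀ᵐ ν ∂(σ.posteriorLaw μ), ν ∈ E.beliefs
  /-- The null experiment is uninformative, feasible and free. -/
  null_uninformative : ∃ m : Measure S, ∀ ω, E.null.kernel ω = m
  null_mem : E.null ∈ E.feasible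
  cost_null : ∀ μ ∈ E.beliefs, E.cost E.null μ = 0
  cost_nonneg : ∀ σ ∈ E.feasible, ∀ μ ∈ E.beliefs, 0 ≤ E.cost σ μ
  /-- The valuation of every type is monotone in the Blackwell order. -/
  blackwell : ∀ θ ∈ E.types, ∀ μ ∈ E.beliefs, ∀ σ σ' : Experiment Ω S, σ'.IsGarblingOf σ →
    ∫ ν, E.valuation ν θ ∂(σ'.posteriorLaw μ) ≤ ∫ ν, E.valuation ν θ ∂(σ.posteriorLaw μ)

/-- Expected valuations make sense, and the maximum in the agent's problem is attained, by a choice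
that depends measurably on her belief. -/
structure WellPosed : Prop where
  valuation_measurable : ∀ θ ∈ E.types, Measurable fun μ => E.valuation μ θ
  valuation_integrable : ∀ θ ∈ E.types, ∀ μ ∈ E.beliefs, ∀ σ : Experiment Ω S,
    Integrable (fun ν => E.valuation ν θ) (σ.posteriorLaw μ)
  exists_best_response : ∀ θ ∈ E.types, ∃ κ : Plan Ω (Belief Ω) S,
    (∀ μ, κ.choice μ ∈ E.feasible) ∧
    (∀ μ ∈ E.beliefs, E.IsOptimalChoice (κ.choice μ) μ θ) ∧
    Measurable fun μ => E.cost (κ.choice μ) μ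

/-- The feasible experiments are closed under sequential learning, and the cost exhibits a (weak)
preference for one-shot learning. The inequality is void if the expected continuation cost is
infinite. -/
def SequentialLearning : Prop :=
  ∀ σ ∈ E.feasible, ∀ κ : Plan Ω S S, (∀ s, κ.choice s ∈ E.feasible) →
    E.seq σ κ ∈ E.feasible ∧
    ∀ μ ∈ E.beliefs,
      Integrable (fun s => E.cost (κ.choice s) (σ.posteriorBelief μ s)) (σ.signalLaw μ) →
      E.cost (E.seq σ κ) μ ≤
        E.cost σ μ + ∫ s, E.cost (κ.choice s) (σ.posteriorBelief μ s) ∂(σ.signalLaw μ)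

/-- The expected utility of type `θ` who reports `θ'`. -/
def reportUtility (M : Mechanism Ω S) (θ θ' : ℝ) : ℝ :=
  (∫ σ, ∫ μ, E.value μ θ ∂(σ.posteriorLaw E.prior) ∂(M.alloc θ')) - M.payment θ'

/-- The interim utility `U(θ)` under truthful reporting. -/
def utility (M : Mechanism Ω S) (θ : ℝ) : ℝ := E.reportUtility M θ θ

def IncentiveCompatible (M : Mechanism Ω S) : Prop :=
  ∀ θ ∈ E.types, ∀ θ' ∈ E.types, E.reportUtility M θ θ' ≤ E.utility M θ

def IndividuallyRational (M : Mechanism Ω S) : Prop :=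
  ∀ θ ∈ E.types, E.value E.prior θ ≤ E.utility M θ

/-- The expected payment. -/
def revenue (M : Mechanism Ω S) : ℝ := ∫ θ in E.lo..E.hi, M.payment θ * E.density θ

/-- An incentive compatible and individually rational mechanism whose expected payment exists. -/
structure IsFeasible (M : Mechanism Ω S) : Prop where
  ic : E.IncentiveCompatible M
  ir : E.IndividuallyRational M
  payment_integrable :
    IntervalIntegrable (fun θ => M.payment θ * E.density θ) volume E.lo E.hi

/-- A revenue-optimal mechanism. -/
def IsOptimal (M : Mechanism Ω S) : Prop :=
  E.IsFeasible M ∧ ∀ M' : Mechanism Ω S, E.IsFeasible M' → E.revenue M' ≤ E.revenue M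

end Environment

end

end InfoSale

/-! Fix a best response of each type after every posterior. The resulting payoff is affine in the
type, with slope the expected unit value of final beliefs and intercept minus the expected cost of
own learning. Incentive compatibility then makes `U` convex with this slope as a subgradient `a`,
and nonnegative costs give `p θ ≤ θ * a θ - U θ`, an equality when nobody learns on her own.
Moreover `a` is at most the unit value of full information.

Compare `U` with the candidate utility `u₀`, which equals the outside option up to `θ*` and then has
the full-information slope. With `d = U - u₀`, integration by parts turns the difference of the
revenue bounds into `-d lo + ∫ φ f d'`. Above `θ*`, `φ ≥ 0` and `d' ≤ 0`. Below it the outside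
option depends on the type, so a pointwise argument fails; instead `-φ f` is nonincreasing with
values in `[0, 1]`, and with `d ≥ 0` this gives `∫ (-φ f) d' ≥ -d lo`. Hence no feasible mechanism
beats the bound at `u₀` (`integral_surplus_le`).

The bound is attained. A low type is sold the experiment she would conduct herself, at its own cost.
By sequential learning, learning further after a feasible experiment is itself feasible at no more
than the total cost (`experimentValue_sub_cost_le`). So no type gains from buying another low type's
experiment at cost, and no type gains from learning further after her own optimal experiment. -/

namespace InfoSale

/-! ### Convex functions on an interval through their subgradients. -/

section Subgradient

/-- `a x` is a subgradient of `u` at every `x` in `s`. -/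
def IsSubgradientOn (u a : ℝ → ℝ) (s : Set ℝ) : Prop :=
  ∀ x ∈ s, ∀ y ∈ s, u x + a x * (y - x) ≤ u y

variable {u a : ℝ → ℝ} {l r : ℝ}

theorem IsSubgradientOn.monotoneOn {s : Set ℝ} (h : IsSubgradientOn u a s) : MonotoneOn a s := by
  intro x hx y hy hxy
  rcases hxy.eq_or_lt with rfl | hlt
  · rfl
  · have h1 := h x hx y hy
    have h2 := h y hy x hx
    by_contra hc
    push Not at hc
    nlinarith [mul_pos (sub_pos.2 hlt) (sub_pos.2 hc)]

/-- Monotonicity traps every slope between `a l` and `a r`, so the constant `|a l| + |a r|` works up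
to the endpoints. -/
theorem IsSubgradientOn.exists_lipschitzOnWith (h : IsSubgradientOn u a (Icc l r)) :
    ∃ K : ℝ≥0, LipschitzOnWith K u (Icc l r) := by
  rcases lt_or_ge r l with hlr | hlr
  · exact ⟨0, by simp [Icc_eq_empty_of_lt hlr]⟩
  have hl := left_mem_Icc.2 hlr
  have hr := right_mem_Icc.2 hlr
  refine ⟨⟨|a l| + |a r|, by positivity⟩, LipschitzOnWith.of_le_add_mul _ ?_⟩
  intro x hx y hy
  have h1 := h x hx y hy
  have m1 := h.monotoneOn hl hx hx.1
  have m2 := h.monotoneOn hx hr hx.2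
  have hb : |a x| ≤ |a l| + |a r| := by
    rw [abs_le]
    constructor
    · linarith [neg_abs_le (a l), abs_nonneg (a r)]
    · linarith [le_abs_self (a r), abs_nonneg (a l)]
  have h3 : a x * (x - y) ≤ (|a l| + |a r|) * |x - y| :=
    calc a x * (x - y) ≤ |a x * (x - y)| := le_abs_self _
      _ = |a x| * |x - y| := abs_mul _ _
      _ ≤ _ := by gcongr
  change u x ≤ u y + (|a l| + |a r|) * dist x y
  rw [Real.dist_eq]
  linarith

theorem IsSubgradientOn.absolutelyContinuousOnInterval (hlr : l ≤ r)
    (h : IsSubgradientOn u a (Icc l r)) : AbsolutelyContinuousOnInterval u l r := by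
  obtain ⟨K, hK⟩ := h.exists_lipschitzOnWith
  exact LipschitzOnWith.absolutelyContinuousOnInterval (K := K) (by rwa [uIcc_of_le hlr])

/-- The two subgradient inequalities between `x` and `y` squeeze the remainder `u y - u x - a x * (y
- x)` between `0` and `(a y - a x) * (y - x)`. -/
theorem IsSubgradientOn.hasDerivAt {x : ℝ} (h : IsSubgradientOn u a (Icc l r))
    (hx : x ∈ Ioo l r) (hc : ContinuousWithinAt a (Icc l r) x) : HasDerivAt u (a x) x := by
  have hc' : ContinuousAt a x := hc.continuousAt (Icc_mem_nhds hx.1 hx.2)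
  rw [hasDerivAt_iff_isLittleO, Asymptotics.isLittleO_iff]
  intro c hcpos
  have hev := Metric.continuousAt_iff'.1 hc' c hcpos
  filter_upwards [hev, Icc_mem_nhds hx.1 hx.2] with y hy hymem
  have h1 := h x (Ioo_subset_Icc_self hx) y hymem
  have h2 := h y hymem x (Ioo_subset_Icc_self hx)
  rw [Real.dist_eq] at hy
  simp only [smul_eq_mul, Real.norm_eq_abs]
  rw [abs_of_nonneg (by linarith)]
  have : (a y - a x) * (y - x) ≤ |a y - a x| * |y - x| := by
    rw [← abs_mul]; exact le_abs_self _
  have h4 : |a y - a x| * |y - x| ≤ c * |y - x| := by gcongr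
  nlinarith

/-- A monotone slope has only countably many discontinuities. -/
theorem IsSubgradientOn.ae_hasDerivAt (h : IsSubgradientOn u a (Icc l r)) :
    ∀ᵐ x, x ∈ Icc l r → HasDerivAt u (a x) x := by
  have h0 := h.monotoneOn.countable_not_continuousWithinAt
  have h1 : ∀ᵐ x : ℝ, x ∉ {x ∈ Icc l r | ¬ContinuousWithinAt a (Icc l r) x} :=
    h0.ae_notMem volume
  have h2 : ∀ᵐ x : ℝ, x ∉ ({l, r} : Set ℝ) := (Set.toFinite _).countable.ae_notMem volume
  filter_upwards [h1, h2] with x hx1 hx2 hx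
  simp only [mem_insert_iff, mem_singleton_iff, not_or] at hx2
  refine h.hasDerivAt ⟨lt_of_le_of_ne hx.1 (Ne.symm hx2.1), lt_of_le_of_ne hx.2 hx2.2⟩ ?_
  by_contra hcon
  exact hx1 ⟨hx, hcon⟩

end Subgradient

/-! ### Integration by parts and a mean value estimate. -/

section ByParts

variable {d a f : ℝ → ℝ} {l r : ℝ}

theorem integral_eq_sub_of_ae_hasDerivAt (hlr : l ≤ r) (hd : AbsolutelyContinuousOnInterval d l r)
    (hda : ∀ᵐ x, x ∈ Icc l r → HasDerivAt d (a x) x) :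
    IntervalIntegrable a volume l r ∧ ∀ t ∈ Icc l r, ∫ x in l..t, a x = d t - d l := by
  have hda' : ∀ᵐ x, x ∈ Icc l r → deriv d x = a x := by
    filter_upwards [hda] with x hx hxm using (hx hxm).deriv
  refine ⟨hd.intervalIntegrable_deriv.congr_ae ?_, fun t ht => ?_⟩
  · rw [Filter.EventuallyEq, ae_restrict_iff' measurableSet_uIoc]
    filter_upwards [hda'] with x hx hxm
    exact hx (by rw [← uIcc_of_le hlr]; exact uIoc_subset_uIcc hxm)
  · have hsub : uIcc l t ⊆ uIcc l r := by
      rw [uIcc_of_le ht.1, uIcc_of_le hlr]; exact Icc_subset_Icc_right ht.2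
    rw [← (hd.mono hsub).integral_deriv_eq_sub]
    refine intervalIntegral.integral_congr_ae ?_
    filter_upwards [hda'] with x hx hxm
    exact (hx (by rw [← uIcc_of_le hlr]; exact hsub (uIoc_subset_uIcc hxm))).symm

/-- Integration by parts against a density: the virtual surplus formula. -/
theorem integral_mul_sub_mul_density (hlr : l ≤ r) (hd : AbsolutelyContinuousOnInterval d l r)
    (hda : ∀ᵐ x, x ∈ Icc l r → HasDerivAt d (a x) x)
    (hf : IntervalIntegrable f volume l r) (hf1 : ∫ x in l..r, f x = 1)
    (haf : IntervalIntegrable (fun x => a x * f x) volume l r) :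
    ∫ x in l..r, (x * a x - d x) * f x
      = -d l + ∫ x in l..r, (x * f x - (1 - ∫ z in l..x, f z)) * a x := by
  obtain ⟨hai, hint⟩ := integral_eq_sub_of_ae_hasDerivAt hlr hd hda
  set F : ℝ → ℝ := fun x => ∫ z in l..x, f z with hF
  have hFac : AbsolutelyContinuousOnInterval F l r :=
    hf.absolutelyContinuousOnInterval_intervalIntegral (by simp)
  have hFd : ∀ᵐ x, x ∈ Icc l r → deriv F x = f x := by
    filter_upwards [hf.ae_hasDerivAt_integral] with x hx hxm
    rw [uIcc_of_le hlr] at hx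
    exact (hx hxm l (left_mem_Icc.2 hlr)).deriv
  have hparts := hd.integral_mul_deriv_eq_deriv_mul hFac
  have e1 : ∫ x in l..r, d x * deriv F x = ∫ x in l..r, d x * f x := by
    refine intervalIntegral.integral_congr_ae ?_
    filter_upwards [hFd] with x hx hxm
    rw [hx (by rw [← uIcc_of_le hlr]; exact uIoc_subset_uIcc hxm)]
  have e2 : ∫ x in l..r, deriv d x * F x = ∫ x in l..r, a x * F x := by
    refine intervalIntegral.integral_congr_ae ?_
    filter_upwards [hda] with x hx hxm
    rw [(hx (by rw [← uIcc_of_le hlr]; exact uIoc_subset_uIcc hxm)).deriv]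
  have hFl : F l = 0 := by simp [hF]
  have hFr : F r = 1 := hf1
  rw [e1, e2, hFl, hFr] at hparts
  have hdf : IntervalIntegrable (fun x => d x * f x) volume l r :=
    hf.continuousOn_mul hd.continuousOn
  have haF : IntervalIntegrable (fun x => a x * F x) volume l r :=
    hai.mul_continuousOn hFac.continuousOn
  have hxaf : IntervalIntegrable (fun x => x * (a x * f x)) volume l r :=
    haf.continuousOn_mul continuousOn_id
  have hr := hint r (right_mem_Icc.2 hlr)
  have s1 : ∫ x in l..r, (x * a x - d x) * f x
      = (∫ x in l..r, x * (a x * f x)) - ∫ x in l..r, d x * f x := by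
    rw [← intervalIntegral.integral_sub hxaf hdf]
    congr 1; ext x; ring
  have s2 : ∫ x in l..r, (x * f x - (1 - F x)) * a x
      = (∫ x in l..r, x * (a x * f x)) - (∫ x in l..r, a x) + ∫ x in l..r, a x * F x := by
    rw [← intervalIntegral.integral_sub hxaf hai,
      ← intervalIntegral.integral_add (hxaf.sub hai) haF]
    congr 1; ext x; ring
  rw [s1, s2, hparts, hr]
  ring

/-- A second mean value estimate: integrating the derivative of a nonnegative function against a
nonincreasing weight with values in `[0, 1]`. -/
theorem neg_le_integral_antitone_mul {m : ℝ → ℝ} (hlr : l ≤ r) (hm : Antitone m)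
    (hm0 : ∀ x ∈ Ioo l r, 0 ≤ m x) (hm1 : ∀ x ∈ Ioo l r, m x ≤ 1)
    (ha : IntervalIntegrable a volume l r)
    (hd : ∀ t ∈ Icc l r, ∫ x in l..t, a x = d t - d l) (hd0 : ∀ t ∈ Icc l r, 0 ≤ d t) :
    -d l ≤ ∫ x in l..r, m x * a x := by
  have ha' : IntegrableOn a (Ioo l r) :=
    ((intervalIntegrable_iff_integrableOn_Ioc_of_le hlr).1 ha).mono_set Ioo_subset_Ioc_self
  have hmeas : Measurable m := hm.measurable
  -- Layer cake: on the interval `m x` is the integral over `y ∈ (0, 1)` of the indicator of `y < m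
  -- x`. As `m` is antitone, each nonempty superlevel set is, up to an endpoint, an initial interval
  -- `(l, T)`, over which `a` integrates to `d T - d l ≥ -d l`.
  have key : ∀ y : ℝ, -d l ≤ ∫ x in Ioo l r, (if y < m x then a x else 0) := by
    intro y
    have hset : MeasurableSet {x | y < m x} := measurableSet_lt measurable_const hmeas
    have e : ∫ x in Ioo l r, (if y < m x then a x else 0)
        = ∫ x in Ioo l r ∩ {x | y < m x}, a x := by
      rw [← setIntegral_indicator hset]; rfl
    rw [e]
    rcases (Ioo l r ∩ {x | y < m x}).eq_empty_or_nonempty with h | h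
    · rw [h]
      simpa using hd0 l (left_mem_Icc.2 hlr)
    · set L := Ioo l r ∩ {x | y < m x} with hL
      have hbdd : BddAbove L := ⟨r, fun x hx => hx.1.2.le⟩
      set T := sSup L
      have hTr : T ≤ r := csSup_le h fun x hx => hx.1.2.le
      obtain ⟨x0, hx0⟩ := h
      have hlT : l ≤ T := hx0.1.1.le.trans (le_csSup hbdd hx0)
      have hs1 : L ⊆ Ioc l T := fun x hx => ⟨hx.1.1, le_csSup hbdd hx⟩
      have hs2 : Ioo l T ⊆ L := by
        intro x hx
        obtain ⟨z, hz, hxz⟩ := exists_lt_of_lt_csSup ⟨x0, hx0⟩ hx.2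
        exact ⟨⟨hx.1, hx.2.trans_le hTr⟩, lt_of_lt_of_le hz.2 (hm hxz.le)⟩
      have hae : L =ᵐ[volume] Ioc l T :=
        (Filter.EventuallyLE.antisymm (hs1.eventuallyLE)
          (Ioo_ae_eq_Ioc.symm.le.trans hs2.eventuallyLE))
      rw [setIntegral_congr_set hae, ← intervalIntegral.integral_of_le hlT, hd T ⟨hlT, hTr⟩]
      linarith [hd0 T ⟨hlT, hTr⟩]
  have hprod : Integrable (fun p : ℝ × ℝ => if p.2 < m p.1 then a p.1 else 0)
      ((volume.restrict (Ioo l r)).prod (volume.restrict (Ioo (0 : ℝ) 1))) := by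
    have h1 : Integrable (fun p : ℝ × ℝ => a p.1)
      ((volume.restrict (Ioo l r)).prod (volume.restrict (Ioo (0 : ℝ) 1))) := ha'.comp_fst _
    exact h1.indicator (s := {p : ℝ × ℝ | p.2 < m p.1})
      (measurableSet_lt measurable_snd (hmeas.comp measurable_fst))
  have hswap := integral_integral_swap (f := fun x y => if y < m x then a x else 0) hprod
  have hinner : ∀ x ∈ Ioo l r,
      ∫ y in Ioo (0 : ℝ) 1, (if y < m x then a x else 0) = m x * a x := by
    intro x hx
    have e : ∫ y in Ioo (0 : ℝ) 1, (if y < m x then a x else 0)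
        = ∫ y in Ioo (0 : ℝ) 1 ∩ Iio (m x), a x := by
      rw [← setIntegral_indicator measurableSet_Iio]; rfl
    rw [e, Ioo_inter_Iio, min_eq_right (hm1 x hx)]
    simp [hm0 x hx]
  rw [intervalIntegral.integral_of_le hlr, integral_Ioc_eq_integral_Ioo,
    ← setIntegral_congr_fun measurableSet_Ioo hinner, hswap]
  calc -d l = ∫ y in Ioo (0 : ℝ) 1, -d l := by simp
    _ ≤ _ := integral_mono (by simp) hprod.integral_prod_right key

end ByParts

/-! ### The type distribution, virtual values and the revenue bound. -/

namespace Environment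

section

variable {Ω S : Type*} [MeasurableSpace Ω] [MeasurableSpace S] {E : Environment Ω S}

theorem HasTypeDensity.density_nonneg_ae (H : E.HasTypeDensity) :
    ∀ᵐ θ, θ ∈ Icc E.lo E.hi → 0 ≤ E.density θ := by
  have h2 : ∀ᵐ x : ℝ, x ∉ ({E.lo, E.hi} : Set ℝ) := (Set.toFinite _).countable.ae_notMem volume
  filter_upwards [h2] with x hx hxm
  simp only [mem_insert_iff, mem_singleton_iff, not_or] at hx
  exact (H.density_pos x ⟨lt_of_le_of_ne hxm.1 (Ne.symm hx.1), lt_of_le_of_ne hxm.2 hx.2⟩).le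

theorem HasTypeDensity.cdf_mono (H : E.HasTypeDensity) {x y : ℝ} (hx : E.lo ≤ x) (hxy : x ≤ y)
    (hy : y ≤ E.hi) : E.cdf x ≤ E.cdf y := by
  have hsub : ∀ z w : ℝ, E.lo ≤ z → z ≤ w → w ≤ E.hi →
      IntervalIntegrable E.density volume z w := fun z w hz hzw hw =>
    H.density_integrable.mono_set (by
      rw [uIcc_of_le hzw, uIcc_of_le H.lo_lt_hi.le]; exact Icc_subset_Icc hz hw)
  have h := intervalIntegral.integral_add_adjacent_intervals
    (hsub E.lo x le_rfl hx (hxy.trans hy)) (hsub x y hx hxy hy)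
  have h0 : 0 ≤ ∫ z in x..y, E.density z := by
    refine intervalIntegral.integral_nonneg_of_ae_restrict hxy ?_
    rw [Filter.EventuallyLE, ae_restrict_iff' measurableSet_Icc]
    filter_upwards [H.density_nonneg_ae] with z hz hzm
    exact hz ⟨hx.trans hzm.1, hzm.2.trans hy⟩
  unfold cdf
  linarith

theorem HasTypeDensity.cdf_le_one (H : E.HasTypeDensity) {x : ℝ} (hx : x ∈ Icc E.lo E.hi) :
    E.cdf x ≤ 1 := by
  have := H.cdf_mono hx.1 hx.2 le_rfl
  rwa [cdf.eq_def E E.hi, H.density_integral] at this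

theorem HasTypeDensity.cdf_nonneg (H : E.HasTypeDensity) {x : ℝ} (hx : x ∈ Icc E.lo E.hi) :
    0 ≤ E.cdf x := by
  have := H.cdf_mono le_rfl hx.1 hx.2
  rwa [cdf.eq_def E E.lo, intervalIntegral.integral_same] at this

theorem HasTypeDensity.virtualValue_mul_density (H : E.HasTypeDensity) {x : ℝ}
    (hx : x ∈ Ioo E.lo E.hi) :
    E.virtualValue x * E.density x = x * E.density x - (1 - E.cdf x) := by
  have := (H.density_pos x hx).ne'
  unfold virtualValue
  field_simp

theorem HasTypeDensity.exists_virtualValue_nonneg (H : E.HasTypeDensity) :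
    ∃ θ ∈ Ioo E.lo E.hi, 0 ≤ E.virtualValue θ := by
  by_contra! hneg
  -- Integration by parts for `d x = x` has a vanishing left side, so the virtual value has mean `lo
  -- ≥ 0` and cannot be negative throughout.
  have hd : IsSubgradientOn (fun x : ℝ => x) (fun _ => 1) (Icc E.lo E.hi) := by
    intro x _ y _; linarith
  have h := integral_mul_sub_mul_density H.lo_lt_hi.le
    (hd.absolutelyContinuousOnInterval H.lo_lt_hi.le) hd.ae_hasDerivAt H.density_integrable
    H.density_integral (by simpa using H.density_integrable)
  simp only [mul_one, sub_self, zero_mul, intervalIntegral.integral_zero] at h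
  have hF : ContinuousOn E.cdf (uIcc E.lo E.hi) :=
    (H.density_integrable.absolutelyContinuousOnInterval_intervalIntegral
      (c := E.lo) (by simp)).continuousOn
  have hint : IntervalIntegrable (fun x => x * E.density x - (1 - E.cdf x)) volume E.lo E.hi :=
    (H.density_integrable.continuousOn_mul continuousOn_id).sub
      ((continuousOn_const.sub hF).intervalIntegrable)
  have hpos : 0 < ∫ x in E.lo..E.hi, -(x * E.density x - (1 - E.cdf x)) := by
    refine intervalIntegral.intervalIntegral_pos_of_pos_on hint.neg ?_ H.lo_lt_hi
    intro x hx
    rw [← H.virtualValue_mul_density hx]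
    have := mul_pos_of_neg_of_neg (hneg x hx) (neg_neg_of_pos (H.density_pos x hx))
    linarith
  rw [intervalIntegral.integral_neg] at hpos
  have := H.lo_nonneg
  unfold cdf at hpos
  linarith

theorem HasTypeDensity.lo_le_monopolyType (H : E.HasTypeDensity) : E.lo ≤ E.monopolyType := by
  obtain ⟨θ, hθ, h0⟩ := H.exists_virtualValue_nonneg
  exact le_csInf ⟨θ, hθ, h0⟩ fun x hx => hx.1.1.le

theorem monopolyType_le {θ : ℝ} (hθ : θ ∈ Ioo E.lo E.hi) (h0 : 0 ≤ E.virtualValue θ) :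
    E.monopolyType ≤ θ :=
  csInf_le ⟨E.lo, fun _ hx => hx.1.1.le⟩ ⟨hθ, h0⟩

theorem HasTypeDensity.monopolyType_lt_hi (H : E.HasTypeDensity) : E.monopolyType < E.hi := by
  obtain ⟨θ, hθ, h0⟩ := H.exists_virtualValue_nonneg
  exact (monopolyType_le hθ h0).trans_lt hθ.2

theorem HasTypeDensity.monopolyType_mem (H : E.HasTypeDensity) : E.monopolyType ∈ E.types :=
  ⟨H.lo_le_monopolyType, H.monopolyType_lt_hi.le⟩

theorem HasTypeDensity.virtualValue_nonneg (H : E.HasTypeDensity) (hreg : E.Regular) {θ : ℝ}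
    (hθ : θ ∈ Ioo E.lo E.hi) (h : E.monopolyType < θ) : 0 ≤ E.virtualValue θ := by
  obtain ⟨x, hx, h0⟩ := H.exists_virtualValue_nonneg
  obtain ⟨z, hz, hzθ⟩ := exists_lt_of_csInf_lt
    (s := {θ | θ ∈ Ioo E.lo E.hi ∧ 0 ≤ E.virtualValue θ}) ⟨x, hx, h0⟩ h
  exact hz.2.trans (hreg hz.1 hθ hzθ.le)

theorem virtualValue_neg {θ : ℝ} (hθ : θ ∈ Ioo E.lo E.hi) (h : θ < E.monopolyType) :
    E.virtualValue θ < 0 := by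
  by_contra! hc
  exact absurd (monopolyType_le hθ hc) (not_le.2 h)

/-- Where the virtual value is negative, regularity makes the marginal revenue monotone. -/
theorem HasTypeDensity.antitoneOn_marginalRevenue (H : E.HasTypeDensity) (hreg : E.Regular) :
    AntitoneOn (fun θ => (1 - E.cdf θ) - θ * E.density θ) (Ioo E.lo E.monopolyType) := by
  intro x hx y hy hxy
  have hx' : x ∈ Ioo E.lo E.hi := ⟨hx.1, hx.2.trans H.monopolyType_lt_hi⟩
  have hy' : y ∈ Ioo E.lo E.hi := ⟨hy.1, hy.2.trans H.monopolyType_lt_hi⟩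
  have ex := H.virtualValue_mul_density hx'
  have ey := H.virtualValue_mul_density hy'
  have hφ := hreg hx' hy' hxy
  have nx := virtualValue_neg hx' hx.2
  have ny := virtualValue_neg hy' hy.2
  have fx := H.density_pos x hx'
  have fy := H.density_pos y hy'
  have hF := H.cdf_mono hx'.1.le hxy hy'.2.le
  have x0 : 0 < x := H.lo_nonneg.trans_lt hx.1
  have hFy := H.cdf_le_one (Ioo_subset_Icc_self hy')
  set p := E.virtualValue x
  set q := E.virtualValue y
  set f := E.density x
  set g := E.density y
  have e1 : (1 - E.cdf x) = (x - p) * f := by linarith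
  have e2 : (1 - E.cdf y) = (y - q) * g := by linarith
  have hle : (y - q) * g ≤ (x - p) * f := by linarith
  change (1 - E.cdf y) - y * g ≤ (1 - E.cdf x) - x * f
  rw [e1, e2]
  -- The marginal revenue is `-φ f = (1 - F) * (-φ / (θ - φ))`, a product of nonnegative
  -- nonincreasing factors. This inequality is the monotonicity of the second factor, with
  -- denominators cleared.
  have g1 : (-q) * (x - p) ≤ (-p) * (y - q) := by nlinarith
  have h1 : (-q * g) * (x - p) ≤ (-p * f) * (x - p) := by
    calc (-q * g) * (x - p) = ((-q) * (x - p)) * g := by ring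
      _ ≤ ((-p) * (y - q)) * g := by gcongr
      _ = (-p) * ((y - q) * g) := by ring
      _ ≤ (-p) * ((x - p) * f) := mul_le_mul_of_nonneg_left hle (by linarith)
      _ = _ := by ring
  have := le_of_mul_le_mul_right h1 (by linarith)
  linarith

theorem HasTypeDensity.intervalIntegrable_mul_density (H : E.HasTypeDensity) {a : ℝ → ℝ}
    (ha : MonotoneOn a E.types) :
    IntervalIntegrable (fun θ => a θ * E.density θ) volume E.lo E.hi := by
  have hle := H.lo_lt_hi.le
  have hai : IntervalIntegrable a volume E.lo E.hi :=
    MonotoneOn.intervalIntegrable (by rwa [uIcc_of_le hle])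
  rw [intervalIntegrable_iff_integrableOn_Ioc_of_le hle] at hai ⊢
  have hf := (intervalIntegrable_iff_integrableOn_Ioc_of_le hle).1 H.density_integrable
  refine Integrable.bdd_mul (c := |a E.lo| + |a E.hi|) hf hai.aestronglyMeasurable ?_
  rw [ae_restrict_iff' measurableSet_Ioc]
  refine Filter.Eventually.of_forall fun x hx => ?_
  have hx' : x ∈ Icc E.lo E.hi := Ioc_subset_Icc_self hx
  have m1 := ha (left_mem_Icc.2 hle) hx' hx'.1
  have m2 := ha hx' (right_mem_Icc.2 hle) hx'.2
  rw [Real.norm_eq_abs, abs_le]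
  constructor
  · linarith [neg_abs_le (a E.lo), abs_nonneg (a E.hi)]
  · linarith [le_abs_self (a E.hi), abs_nonneg (a E.lo)]

theorem HasTypeDensity.intervalIntegrable_surplus (H : E.HasTypeDensity) {u a : ℝ → ℝ}
    (h : IsSubgradientOn u a E.types) :
    IntervalIntegrable (fun θ => (θ * a θ - u θ) * E.density θ) volume E.lo E.hi := by
  have h1 := (H.intervalIntegrable_mul_density h.monotoneOn).continuousOn_mul continuousOn_id
  have h2 := H.density_integrable.continuousOn_mul
    (h.absolutelyContinuousOnInterval H.lo_lt_hi.le).continuousOn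
  refine (h1.sub h2).congr fun x _ => ?_
  simp only [id_eq]
  ring

/-- Among the convex utilities above `u₀` on `[lo, θ*]`, and with slope at most the slope of `u₀`
above `θ*`, the utility `u₀` maximizes the expected payment. -/
theorem HasTypeDensity.integral_surplus_le (H : E.HasTypeDensity) (hreg : E.Regular)
    {u a u₀ a₀ : ℝ → ℝ} (h : IsSubgradientOn u a E.types) (h₀ : IsSubgradientOn u₀ a₀ E.types)
    (hu : ∀ θ ∈ Icc E.lo E.monopolyType, u₀ θ ≤ u θ)
    (ha : ∀ θ ∈ Ioo E.monopolyType E.hi, a θ ≤ a₀ θ) :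
    ∫ θ in E.lo..E.hi, (θ * a θ - u θ) * E.density θ
      ≤ ∫ θ in E.lo..E.hi, (θ * a₀ θ - u₀ θ) * E.density θ := by
  have hle := H.lo_lt_hi.le
  set c := E.monopolyType with hc
  have hlc : E.lo ≤ c := H.lo_le_monopolyType
  have hch : c < E.hi := H.monopolyType_lt_hi
  set d : ℝ → ℝ := fun θ => u θ - u₀ θ
  set b : ℝ → ℝ := fun θ => a θ - a₀ θ
  have hdac : AbsolutelyContinuousOnInterval d E.lo E.hi :=
    (h.absolutelyContinuousOnInterval hle).sub (h₀.absolutelyContinuousOnInterval hle)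
  have hdb : ∀ᵐ x, x ∈ Icc E.lo E.hi → HasDerivAt d (b x) x := by
    filter_upwards [h.ae_hasDerivAt, h₀.ae_hasDerivAt] with x h1 h2 hx
    exact (h1 hx).sub (h2 hx)
  obtain ⟨hbi, hbint⟩ := integral_eq_sub_of_ae_hasDerivAt hle hdac hdb
  have hbf : IntervalIntegrable (fun x => b x * E.density x) volume E.lo E.hi := by
    refine ((H.intervalIntegrable_mul_density h.monotoneOn).sub
      (H.intervalIntegrable_mul_density h₀.monotoneOn)).congr fun x _ => ?_
    simp only [b]; ring
  have hparts := integral_mul_sub_mul_density hle hdac hdb H.density_integrable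
    H.density_integral hbf
  have hdiff : ∫ θ in E.lo..E.hi, (θ * b θ - d θ) * E.density θ
      = (∫ θ in E.lo..E.hi, (θ * a θ - u θ) * E.density θ)
        - ∫ θ in E.lo..E.hi, (θ * a₀ θ - u₀ θ) * E.density θ := by
    rw [← intervalIntegral.integral_sub (H.intervalIntegrable_surplus h)
      (H.intervalIntegrable_surplus h₀)]
    congr 1; ext x; simp only [b, d]; ring
  have hF : ContinuousOn E.cdf (uIcc E.lo E.hi) :=
    (H.density_integrable.absolutelyContinuousOnInterval_intervalIntegral
      (c := E.lo) (by simp)).continuousOn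
  have hmb : IntervalIntegrable (fun x => (x * E.density x - (1 - E.cdf x)) * b x) volume
      E.lo E.hi := by
    refine ((hbf.continuousOn_mul continuousOn_id).sub
      (hbi.continuousOn_mul ((continuousOn_const (c := (1 : ℝ))).sub hF))).congr fun x _ => ?_
    simp only [id_eq, Pi.sub_apply]; ring
  have hsubl : uIcc E.lo c ⊆ uIcc E.lo E.hi := by
    rw [uIcc_of_le hlc, uIcc_of_le hle]; exact Icc_subset_Icc_right hch.le
  have hsubr : uIcc c E.hi ⊆ uIcc E.lo E.hi := by
    rw [uIcc_of_le hch.le, uIcc_of_le hle]; exact Icc_subset_Icc_left hlc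
  have hsplit := intervalIntegral.integral_add_adjacent_intervals
    (hmb.mono_set hsubl) (hmb.mono_set hsubr)
  -- Above `θ*` the integrand has a sign: nonnegative virtual value times nonpositive slope
  -- difference.
  have hright : ∫ x in c..E.hi, (x * E.density x - (1 - E.cdf x)) * b x ≤ 0 := by
    rw [intervalIntegral.integral_of_le hch.le, integral_Ioc_eq_integral_Ioo]
    refine setIntegral_nonpos measurableSet_Ioo fun x hx => ?_
    have hx' : x ∈ Ioo E.lo E.hi := ⟨hlc.trans_lt hx.1, hx.2⟩
    rw [← H.virtualValue_mul_density hx']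
    exact mul_nonpos_of_nonneg_of_nonpos
      (mul_nonneg (H.virtualValue_nonneg hreg hx' hx.1) (H.density_pos x hx').le)
      (sub_nonpos.2 (ha x hx))
  have hm : ∀ x ∈ Ioo E.lo c, (1 - E.cdf x) - x * E.density x ∈ Icc (0 : ℝ) 1 := by
    intro x hx
    have hx' : x ∈ Ioo E.lo E.hi := ⟨hx.1, hx.2.trans hch⟩
    have e := H.virtualValue_mul_density hx'
    have n := virtualValue_neg hx' hx.2
    have fx := H.density_pos x hx'
    have := H.cdf_nonneg (Ioo_subset_Icc_self hx')
    have x0 : 0 < x := H.lo_nonneg.trans_lt hx.1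
    constructor
    · nlinarith
    · nlinarith
  -- The weight is antitone only below `θ*`; a global antitone extension also supplies its
  -- measurability.
  obtain ⟨m, hmanti, hmeq⟩ := (H.antitoneOn_marginalRevenue hreg).exists_antitone_extension
    ⟨0, by rintro _ ⟨x, hx, rfl⟩; exact (hm x hx).1⟩
    ⟨1, by rintro _ ⟨x, hx, rfl⟩; exact (hm x hx).2⟩
  have hleft := neg_le_integral_antitone_mul (d := d) hlc hmanti
    (fun x hx => by rw [← hmeq hx]; exact (hm x hx).1)
    (fun x hx => by rw [← hmeq hx]; exact (hm x hx).2)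
    (hbi.mono_set hsubl) (fun t ht => hbint t ⟨ht.1, ht.2.trans hch.le⟩)
    (fun t ht => sub_nonneg.2 (hu t ht))
  have hleq : ∫ x in E.lo..c, m x * b x
      = -∫ x in E.lo..c, (x * E.density x - (1 - E.cdf x)) * b x := by
    rw [← intervalIntegral.integral_neg, intervalIntegral.integral_of_le hlc,
      intervalIntegral.integral_of_le hlc, integral_Ioc_eq_integral_Ioo,
      integral_Ioc_eq_integral_Ioo]
    refine setIntegral_congr_fun measurableSet_Ioo fun x hx => ?_
    rw [← hmeq hx]
    ring
  change _ = -d E.lo + ∫ x in E.lo..E.hi, (x * E.density x - (1 - E.cdf x)) * b x at hparts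
  linarith

end

end Environment

/-! ### Bayesian updating and the law of the posterior. -/

section Beliefs

variable {Ω S : Type*} [MeasurableSpace Ω] [MeasurableSpace S]

/-- The kernel that draws the state from a belief. -/
noncomputable def beliefKernel (Ω : Type*) [MeasurableSpace Ω] : Kernel (Belief Ω) Ω where
  toFun μ := (μ : Measure Ω)
  measurable' := measurable_subtype_coe

instance : IsMarkovKernel (beliefKernel Ω) := ⟨fun μ => μ.2⟩

theorem _root_.ProbabilityTheory.Kernel.measurable_belief {X : Type*} [MeasurableSpace X]
    (κ : Kernel X Ω) [hκ : IsMarkovKernel κ] :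
    Measurable fun x => (⟨κ x, hκ.isProbabilityMeasure x⟩ : Belief Ω) :=
  κ.measurable.subtype_mk

/-- The degenerate belief at a state. -/
noncomputable def diracBelief (ω : Ω) : Belief Ω := ⟨Measure.dirac ω, inferInstance⟩

theorem measurable_diracBelief : Measurable (diracBelief : Ω → Belief Ω) :=
  Measure.measurable_dirac.subtype_mk

variable [StandardBorelSpace Ω] [Nonempty Ω]

theorem Experiment.measurable_posteriorBelief (σ : Experiment Ω S) (μ : Belief Ω) :
    Measurable (σ.posteriorBelief μ) :=
  Kernel.measurable_belief _

instance (σ : Experiment Ω S) (μ : Belief Ω) : IsProbabilityMeasure (σ.signalLaw μ) := by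
  unfold Experiment.signalLaw; infer_instance

instance (σ : Experiment Ω S) (μ : Belief Ω) : IsProbabilityMeasure (σ.posteriorLaw μ) :=
  Measure.isProbabilityMeasure_map (σ.measurable_posteriorBelief μ).aemeasurable

omit [StandardBorelSpace Ω] [Nonempty Ω] in
theorem Experiment.lintegral_signalLaw (σ : Experiment Ω S) (μ : Belief Ω) {h : S → ENNReal}
    (hh : Measurable h) : ∫⁻ s, h s ∂(σ.signalLaw μ) = ∫⁻ ω, ∫⁻ s, h s ∂(σ.kernel ω) ∂(μ : Measure Ω) :=
  Measure.lintegral_bind σ.kernel.aemeasurable hh.aemeasurable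

/-- Bayes' rule. -/
theorem Experiment.lintegral_posterior (σ : Experiment Ω S) (μ : Belief Ω) {h : S × Ω → ENNReal}
    (hh : Measurable h) :
    ∫⁻ s, ∫⁻ ω, h (s, ω) ∂(σ.posteriorBelief μ s : Measure Ω) ∂(σ.signalLaw μ)
      = ∫⁻ ω, ∫⁻ s, h (s, ω) ∂(σ.kernel ω) ∂(μ : Measure Ω) := by
  have e := congrArg (fun m => ∫⁻ p, h p ∂m)
    (compProd_posterior_eq_map_swap (κ := σ.kernel) (μ := (μ : Measure Ω)))
  have hs : Measurable fun p : Ω × S => h p.swap := hh.comp measurable_swap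
  rw [Measure.lintegral_compProd hh, lintegral_map hh measurable_swap,
    Measure.lintegral_compProd hs] at e
  exact e

/-- A family of beliefs satisfying Bayes' rule gives the distribution over posteriors. -/
theorem Experiment.posteriorLaw_eq_map (σ : Experiment Ω S) (μ : Belief Ω) {q : S → Belief Ω}
    (hq : Measurable q)
    (hbayes : ∀ h : S × Ω → ENNReal, Measurable h →
      ∫⁻ s, ∫⁻ ω, h (s, ω) ∂(q s : Measure Ω) ∂(σ.signalLaw μ)
        = ∫⁻ ω, ∫⁻ s, h (s, ω) ∂(σ.kernel ω) ∂(μ : Measure Ω)) :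
    σ.posteriorLaw μ = (σ.signalLaw μ).map q := by
  -- Posteriors are almost surely unique, because Bayes' rule fixes the joint law of signal and
  -- state.
  have hae : (beliefKernel Ω).comap q hq =ᵐ[σ.kernel ∘ₘ (μ : Measure Ω)]
      posterior σ.kernel (μ : Measure Ω) := by
    refine ae_eq_posterior_of_compProd_eq ?_
    refine Measure.ext_of_lintegral _ fun h hh => ?_
    have hs : Measurable fun p : Ω × S => h p.swap := hh.comp measurable_swap
    rw [Measure.lintegral_compProd hh, lintegral_map hh measurable_swap,
      Measure.lintegral_compProd hs]
    exact hbayes h hh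
  refine Measure.map_congr ?_
  filter_upwards [hae] with s hs
  exact Subtype.ext hs.symm

/-- Bayes plausibility: the posteriors average to the belief one started from. -/
theorem Experiment.posteriorLaw_bind (σ : Experiment Ω S) (μ : Belief Ω) :
    (σ.posteriorLaw μ).bind (beliefKernel Ω) = (μ : Measure Ω) := by
  refine Measure.ext_of_lintegral _ fun h hh => ?_
  rw [Measure.lintegral_bind (beliefKernel Ω).aemeasurable hh.aemeasurable,
    Experiment.posteriorLaw,
    lintegral_map hh.lintegral_kernel (σ.measurable_posteriorBelief μ)]
  refine (σ.lintegral_posterior μ (h := fun p => h p.2) (hh.comp measurable_snd)).trans ?_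
  simp

theorem Experiment.posteriorLaw_of_const {σ : Experiment Ω S} {m : Measure S}
    (hσ : ∀ ω, σ.kernel ω = m) (μ : Belief Ω) : σ.posteriorLaw μ = Measure.dirac μ := by
  have hm : IsProbabilityMeasure m := by
    rw [← hσ (Classical.arbitrary Ω)]; infer_instance
  have hsig : σ.signalLaw μ = m := by
    refine Measure.ext_of_lintegral _ fun h hh => ?_
    rw [σ.lintegral_signalLaw μ hh]
    simp [hσ]
  rw [σ.posteriorLaw_eq_map μ (q := fun _ => μ) measurable_const, Measure.map_const]
  · simp
  · intro h hh
    simp only [hσ, hsig]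
    have hμ : IsProbabilityMeasure (μ : Measure Ω) := μ.2
    exact lintegral_lintegral_swap (hh.aemeasurable)

omit [StandardBorelSpace Ω] in
theorem Experiment.isGarblingOf_of_const {σ : Experiment Ω S} {m : Measure S}
    (hσ : ∀ ω, σ.kernel ω = m) (τ : Experiment Ω S) : σ.IsGarblingOf τ := by
  have hm : IsProbabilityMeasure m := by
    rw [← hσ (Classical.arbitrary Ω)]; infer_instance
  refine ⟨Kernel.const S m, inferInstance, ?_⟩
  ext ω : 1
  rw [Kernel.const_comp']
  simp [hσ]

end Beliefs

/-! ### Full information. -/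

section Full

variable {Ω S : Type*} [MeasurableSpace Ω] [StandardBorelSpace Ω] [Nonempty Ω]
  [MeasurableSpace S] (E : Environment Ω S)

theorem Environment.posteriorLaw_full (μ : Belief Ω) :
    E.full.posteriorLaw μ = (μ : Measure Ω).map diracBelief := by
  -- `q` decodes the state from the signal; its values off the range of `reveal` are arbitrary,
  -- since such signals never occur.
  obtain ⟨q, hq, hqr⟩ := E.reveal_embedding.exists_measurable_extend measurable_diracBelief
    (fun _ => ⟨diracBelief (Classical.arbitrary Ω)⟩)
  have hk : ∀ ω, E.full.kernel ω = Measure.dirac (E.reveal ω) := fun ω =>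
    Kernel.deterministic_apply E.reveal_embedding.measurable ω
  have hsig : E.full.signalLaw μ = (μ : Measure Ω).map E.reveal := by
    refine Measure.ext_of_lintegral _ fun h hh => ?_
    rw [E.full.lintegral_signalLaw μ hh, lintegral_map hh E.reveal_embedding.measurable]
    simp_rw [hk]
    exact lintegral_congr fun ω => lintegral_dirac' _ hh
  rw [E.full.posteriorLaw_eq_map μ hq, hsig,
    Measure.map_map hq E.reveal_embedding.measurable, hqr]
  intro h hh
  have hm : Measurable fun s => ∫⁻ ω, h (s, ω) ∂(q s : Measure Ω) :=
    hh.lintegral_kernel_prod_right' (κ := (beliefKernel Ω).comap q hq)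
  rw [hsig, lintegral_map hm E.reveal_embedding.measurable]
  refine lintegral_congr fun ω => ?_
  have e : (q (E.reveal ω) : Measure Ω) = Measure.dirac ω := by
    have := congrFun hqr ω
    simp only [Function.comp_apply] at this
    rw [this]; rfl
  have h1 : Measurable fun ω' => h (E.reveal ω, ω') := hh.comp measurable_prodMk_left
  have h2 : Measurable fun s => h (s, ω) := hh.comp measurable_prodMk_right
  rw [e, hk, lintegral_dirac' _ h1, lintegral_dirac' _ h2]

omit [StandardBorelSpace Ω] in
-- The garbling decodes the state from the revealing signal and then simulates `σ`.
theorem Environment.isGarblingOf_full (σ : Experiment Ω S) : σ.IsGarblingOf E.full := by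
  obtain ⟨g, hg, hgr⟩ := E.reveal_embedding.exists_measurable_extend measurable_id
    (fun _ => inferInstanceAs (Nonempty Ω))
  refine ⟨σ.kernel.comap g hg, inferInstance, ?_⟩
  ext ω : 1
  have hk : E.full.kernel ω = Measure.dirac (E.reveal ω) :=
    Kernel.deterministic_apply E.reveal_embedding.measurable ω
  rw [Kernel.comp_apply, hk, Measure.dirac_bind (Kernel.measurable _), Kernel.comap_apply]
  have := congrFun hgr ω
  simp only [Function.comp_apply, id_eq] at this
  rw [this]

end Full

/-! ### Sequential learning and the law of two-stage posteriors. -/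

section Sequential

variable {Ω S : Type*} [MeasurableSpace Ω] [StandardBorelSpace Ω] [Nonempty Ω]
  [MeasurableSpace S] [StandardBorelSpace S]

namespace Plan

/-- The joint law of the signal of `κ(μ)` and of the state, at the belief `μ`. -/
noncomputable def joint (κ : Plan Ω (Belief Ω) S) : Kernel (Belief Ω) (S × Ω) :=
  (beliefKernel Ω ⊗ₖ κ.kernel.comap Prod.swap measurable_swap).map Prod.swap

instance (κ : Plan Ω (Belief Ω) S) : IsMarkovKernel κ.joint :=
  Kernel.IsMarkovKernel.map _ measurable_swap

omit [StandardBorelSpace Ω] [Nonempty Ω] [StandardBorelSpace S] in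
theorem lintegral_joint (κ : Plan Ω (Belief Ω) S) (μ : Belief Ω) {h : S × Ω → ENNReal}
    (hh : Measurable h) :
    ∫⁻ p, h p ∂(κ.joint μ) = ∫⁻ ω, ∫⁻ s, h (s, ω) ∂(κ.kernel (ω, μ)) ∂(μ : Measure Ω) := by
  have hs : Measurable fun p : Ω × S => h p.swap := hh.comp measurable_swap
  rw [joint, Kernel.map_apply _ measurable_swap, lintegral_map hh measurable_swap,
    Kernel.lintegral_compProd _ _ _ hs]
  rfl

theorem lintegral_joint_eq (κ : Plan Ω (Belief Ω) S) (μ : Belief Ω) {h : S × Ω → ENNReal}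
    (hh : Measurable h) :
    ∫⁻ p, h p ∂(κ.joint μ)
      = ∫⁻ s, ∫⁻ ω, h (s, ω) ∂(κ.joint.condKernel (μ, s)) ∂(κ.joint.fst μ) := by
  conv_lhs => rw [← κ.joint.disintegrate κ.joint.condKernel]
  exact Kernel.lintegral_compProd _ _ _ hh

omit [StandardBorelSpace Ω] [Nonempty Ω] [StandardBorelSpace S] in
theorem joint_fst_apply (κ : Plan Ω (Belief Ω) S) (μ : Belief Ω) :
    κ.joint.fst μ = (κ.choice μ).signalLaw μ := by
  refine Measure.ext_of_lintegral _ fun h hh => ?_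
  have hs : Measurable fun p : S × Ω => h p.1 := hh.comp measurable_fst
  rw [Kernel.lintegral_fst _ _ hh, κ.lintegral_joint μ hs,
    Experiment.lintegral_signalLaw _ _ hh]
  rfl

/-- A version of the posterior that is jointly measurable in the belief and the signal. -/
noncomputable def update (κ : Plan Ω (Belief Ω) S) (x : Belief Ω × S) : Belief Ω :=
  ⟨κ.joint.condKernel x, inferInstance⟩

theorem measurable_update (κ : Plan Ω (Belief Ω) S) : Measurable κ.update :=
  Kernel.measurable_belief _

/-- The kernel that maps a belief to the distribution over posteriors after the plan. -/
noncomputable def continuation (κ : Plan Ω (Belief Ω) S) : Kernel (Belief Ω) (Belief Ω) :=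
  (Kernel.id ×ₖ κ.joint.fst).map κ.update

instance (κ : Plan Ω (Belief Ω) S) : IsMarkovKernel κ.continuation :=
  Kernel.IsMarkovKernel.map _ κ.measurable_update

theorem lintegral_continuation (κ : Plan Ω (Belief Ω) S) (μ : Belief Ω) {h : Belief Ω → ENNReal}
    (hh : Measurable h) :
    ∫⁻ ν, h ν ∂(κ.continuation μ) = ∫⁻ s, h (κ.update (μ, s)) ∂(κ.joint.fst μ) := by
  have hs : Measurable fun x => h (κ.update x) := hh.comp κ.measurable_update
  rw [continuation, Kernel.map_apply _ κ.measurable_update, lintegral_map hh κ.measurable_update,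
    Kernel.lintegral_id_prod hs]

theorem continuation_apply (κ : Plan Ω (Belief Ω) S) (μ : Belief Ω) :
    κ.continuation μ = (κ.choice μ).posteriorLaw μ := by
  have hq : Measurable fun s => κ.update (μ, s) := κ.measurable_update.comp measurable_prodMk_left
  rw [(κ.choice μ).posteriorLaw_eq_map μ hq]
  · refine Measure.ext_of_lintegral _ fun h hh => ?_
    rw [κ.lintegral_continuation μ hh, lintegral_map hh hq, joint_fst_apply]
  · intro h hh
    rw [← joint_fst_apply]
    exact (κ.lintegral_joint_eq μ hh).symm.trans (κ.lintegral_joint μ hh)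

/-- The plan that, after a signal of `σ`, follows `κ` at the posterior belief. -/
noncomputable def after (κ : Plan Ω (Belief Ω) S) (σ : Experiment Ω S) (μ : Belief Ω) :
    Plan Ω S S where
  kernel := κ.kernel.comap (fun p => (p.1, σ.posteriorBelief μ p.2))
    (measurable_fst.prodMk ((σ.measurable_posteriorBelief μ).comp measurable_snd))
  markov := inferInstance

/-- Bayes' rule for sequential learning. -/
theorem lintegral_after (κ : Plan Ω (Belief Ω) S) (σ : Experiment Ω S) (μ : Belief Ω)
    {h : (S × S) × Ω → ENNReal} (hh : Measurable h) :
    ∫⁻ ω, ∫⁻ s, ∫⁻ s', h ((s, s'), ω) ∂((κ.after σ μ).kernel (ω, s)) ∂(σ.kernel ω) ∂(μ : Measure Ω)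
      = ∫⁻ s, ∫⁻ s', ∫⁻ ω, h ((s, s'), ω) ∂(κ.update (σ.posteriorBelief μ s, s') : Measure Ω)
          ∂(κ.joint.fst (σ.posteriorBelief μ s)) ∂(σ.signalLaw μ) := by
  have hm : Measurable fun p : S × Ω =>
      ∫⁻ s', h ((p.1, s'), p.2) ∂((κ.after σ μ).kernel (p.2, p.1)) := by
    have h1 : Measurable fun z : (S × Ω) × S => h ((z.1.1, z.2), z.1.2) := by fun_prop
    exact h1.lintegral_kernel_prod_right' (κ := (κ.after σ μ).kernel.comap Prod.swap measurable_swap)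
  -- Bayes' rule handles the first signal; the second is then disintegrated at the posterior belief
  -- it starts from.
  rw [← σ.lintegral_posterior μ hm]
  refine lintegral_congr fun s => ?_
  have hs : Measurable fun p : S × Ω => h ((s, p.1), p.2) := by fun_prop
  exact (κ.lintegral_joint _ hs).symm.trans (κ.lintegral_joint_eq _ hs)

end Plan

omit [StandardBorelSpace Ω] [Nonempty Ω] [StandardBorelSpace S] in
theorem Environment.lintegral_seq_kernel (E : Environment Ω S) (σ : Experiment Ω S)
    (κ : Plan Ω S S) (ω : Ω) {h : S → ENNReal} (hh : Measurable h) :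
    ∫⁻ x, h x ∂((E.seq σ κ).kernel ω)
      = ∫⁻ s, ∫⁻ s', h (E.pair (s, s')) ∂(κ.kernel (ω, s)) ∂(σ.kernel ω) := by
  have hp := E.pair_embedding.measurable
  have hs : Measurable fun x => h (E.pair x) := hh.comp hp
  rw [Environment.seq, Kernel.map_apply _ hp, lintegral_map hh hp,
    Kernel.lintegral_compProd _ _ _ hs]

/-- Learning with `σ` and then following the plan `κ` induces the same distribution over posteriors
as the sequential experiment. -/
theorem Environment.posteriorLaw_seq_after (E : Environment Ω S) (σ : Experiment Ω S)
    (κ : Plan Ω (Belief Ω) S) (μ : Belief Ω) :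
    (E.seq σ (κ.after σ μ)).posteriorLaw μ = (σ.posteriorLaw μ).bind κ.continuation := by
  have hp := E.pair_embedding.measurable
  have hpost := σ.measurable_posteriorBelief μ
  have hg : Measurable fun x : S × S => κ.update (σ.posteriorBelief μ x.1, x.2) :=
    κ.measurable_update.comp ((hpost.comp measurable_fst).prodMk measurable_snd)
  -- Updating on an encoded pair of signals means updating twice; values off the range of `pair` are
  -- irrelevant.
  obtain ⟨q, hq, hqr⟩ := E.pair_embedding.exists_measurable_extend hg (fun _ => ⟨μ⟩)
  have hqr' : ∀ s s', q (E.pair (s, s')) = κ.update (σ.posteriorBelief μ s, s') := fun s s' =>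
    congrFun hqr (s, s')
  have hsig : ∀ h : S → ENNReal, Measurable h →
      ∫⁻ x, h x ∂((E.seq σ (κ.after σ μ)).signalLaw μ)
        = ∫⁻ s, ∫⁻ s', h (E.pair (s, s')) ∂(κ.joint.fst (σ.posteriorBelief μ s))
            ∂(σ.signalLaw μ) := by
    intro h hh
    rw [Experiment.lintegral_signalLaw _ _ hh]
    simp_rw [E.lintegral_seq_kernel _ _ _ hh]
    refine (κ.lintegral_after σ μ (h := fun z => h (E.pair z.1))
      (hh.comp (hp.comp measurable_fst))).trans ?_
    simp
  rw [Experiment.posteriorLaw_eq_map _ μ hq]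
  · refine Measure.ext_of_lintegral _ fun h hh => ?_
    have hs : Measurable fun x => h (q x) := hh.comp hq
    rw [lintegral_map hh hq, hsig _ hs,
      Measure.lintegral_bind κ.continuation.aemeasurable hh.aemeasurable,
      Experiment.posteriorLaw, lintegral_map hh.lintegral_kernel hpost]
    simp_rw [κ.lintegral_continuation _ hh, hqr']
  · intro h hh
    have hm : Measurable fun x => ∫⁻ ω, h (x, ω) ∂(q x : Measure Ω) :=
      hh.lintegral_kernel_prod_right' (κ := (beliefKernel Ω).comap q hq)
    rw [hsig _ hm]
    simp_rw [hqr']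
    have hω : ∀ ω, ∫⁻ x, h (x, ω) ∂((E.seq σ (κ.after σ μ)).kernel ω)
        = ∫⁻ s, ∫⁻ s', h (E.pair (s, s'), ω) ∂((κ.after σ μ).kernel (ω, s)) ∂(σ.kernel ω) :=
      fun ω => E.lintegral_seq_kernel _ _ _ (hh.comp measurable_prodMk_right)
    simp_rw [hω]
    exact (κ.lintegral_after σ μ (h := fun z => h (E.pair z.1, z.2))
      (hh.comp ((hp.comp measurable_fst).prodMk measurable_snd))).symm

end Sequential

theorem integrable_integral_of_bind {X Y : Type*} [MeasurableSpace X] [MeasurableSpace Y]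
    {m : Measure X} [SFinite m] {κ : Kernel X Y} [IsSFiniteKernel κ] {g : Y → ℝ}
    (hg : Integrable g (m.bind κ)) : Integrable (fun x => ∫ y, g y ∂(κ x)) m := by
  rw [Measure.comp_eq_comp_const_apply] at hg
  simpa using hg.integral_comp

theorem integral_bind_kernel {X Y : Type*} [MeasurableSpace X] [MeasurableSpace Y]
    {m : Measure X} [SFinite m] {κ : Kernel X Y} [IsSFiniteKernel κ] {g : Y → ℝ}
    (hg : Integrable g (m.bind κ)) : ∫ y, g y ∂(m.bind κ) = ∫ x, ∫ y, g y ∂(κ x) ∂m := by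
  rw [Measure.comp_eq_comp_const_apply] at hg ⊢
  simpa using Kernel.integral_comp hg

section

variable {Ω S : Type*} [MeasurableSpace Ω] [StandardBorelSpace Ω] [Nonempty Ω]
  [MeasurableSpace S]

/-- The distribution over posteriors as a kernel on experiments. -/
noncomputable def posteriorKernel (S : Type*) [MeasurableSpace S] (μ : Belief Ω) :
    Kernel (Experiment Ω S) (Belief Ω) where
  toFun σ := σ.posteriorLaw μ
  measurable' := by
    rw [measurable_iff_comap_le]
    exact le_iSup (fun μ : Belief Ω => MeasurableSpace.comap
      (fun σ : Experiment Ω S => σ.posteriorLaw μ) inferInstance) μ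

theorem measurable_integral_posteriorLaw (μ : Belief Ω) {g : Belief Ω → ℝ} (hg : Measurable g) :
    Measurable fun σ : Experiment Ω S => ∫ ν, g ν ∂(σ.posteriorLaw μ) :=
  (hg.stronglyMeasurable.integral_kernel (κ := posteriorKernel S μ)).measurable

end

/-! ### The value of information per unit of the type. -/

namespace Environment

variable {Ω S : Type*} [MeasurableSpace Ω] [StandardBorelSpace Ω] [Nonempty Ω]
  [MeasurableSpace S] (E : Environment Ω S)

/-- The valuation of a belief per unit of the type. -/
noncomputable def unitValue (μ : Belief Ω) : ℝ := E.valuation μ E.hi / E.hi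

/-- The expected unit value of the posterior of `σ`. -/
noncomputable def gain (σ : Experiment Ω S) (μ : Belief Ω) : ℝ :=
  ∫ ν, E.unitValue ν ∂(σ.posteriorLaw μ)

/-- The expected value of receiving `σ` at the prior. -/
noncomputable def experimentValue (σ : Experiment Ω S) (θ : ℝ) : ℝ :=
  ∫ μ, E.value μ θ ∂(σ.posteriorLaw E.prior)

/-- The assumptions on the environment, apart from regularity of the type distribution. -/
structure Admissible : Prop where
  standing : E.Standing
  wellPosed : E.WellPosed
  typeDensity : E.HasTypeDensity
  convexSeparable : E.ConvexSeparable
  sequential : E.SequentialLearning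

/-- `κ` is a measurable best response of type `θ`. -/
structure IsBestResponse (κ : Plan Ω (Belief Ω) S) (θ : ℝ) : Prop where
  feasible : ∀ μ, κ.choice μ ∈ E.feasible
  optimal : ∀ μ ∈ E.beliefs, E.IsOptimalChoice (κ.choice μ) μ θ
  measurable_cost : Measurable fun μ => E.cost (κ.choice μ) μ

variable {E}

namespace Admissible

variable (A : E.Admissible)
include A

theorem hi_pos : 0 < E.hi := A.typeDensity.lo_nonneg.trans_lt A.typeDensity.lo_lt_hi

theorem hi_mem : E.hi ∈ E.types := right_mem_Icc.2 A.typeDensity.lo_lt_hi.le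

theorem type_nonneg {θ : ℝ} (hθ : θ ∈ E.types) : 0 ≤ θ := A.typeDensity.lo_nonneg.trans hθ.1

theorem exists_isBestResponse {θ : ℝ} (hθ : θ ∈ E.types) :
    ∃ κ : Plan Ω (Belief Ω) S, E.IsBestResponse κ θ := by
  obtain ⟨κ, h1, h2, h3⟩ := A.wellPosed.exists_best_response θ hθ
  exact ⟨κ, h1, h2, h3⟩

theorem measurable_unitValue : Measurable E.unitValue :=
  (A.wellPosed.valuation_measurable E.hi A.hi_mem).div_const _

/-- On `beliefs`, `unitValue` recovers the `v` of the separable form. It replaces `v` because its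
measurability and integrability are inherited from the valuation of type `hi > 0`. -/
theorem valuation_eq {μ : Belief Ω} (hμ : μ ∈ E.beliefs) {θ : ℝ} (hθ : θ ∈ E.types) :
    E.valuation μ θ = E.unitValue μ * θ := by
  obtain ⟨v, hv, -⟩ := A.convexSeparable
  have := A.hi_pos.ne'
  rw [unitValue, hv μ hμ θ hθ, hv μ hμ E.hi A.hi_mem]
  field_simp

theorem ae_mem_beliefs (σ : Experiment Ω S) {μ : Belief Ω} (hμ : μ ∈ E.beliefs) :
    ∀ᵐ ν ∂(σ.posteriorLaw μ), ν ∈ E.beliefs :=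
  A.standing.posterior_mem μ hμ σ

theorem integrable_unitValue (σ : Experiment Ω S) {μ : Belief Ω} (hμ : μ ∈ E.beliefs) :
    Integrable E.unitValue (σ.posteriorLaw μ) :=
  (A.wellPosed.valuation_integrable E.hi A.hi_mem μ hμ σ).div_const _

theorem integral_valuation (σ : Experiment Ω S) {μ : Belief Ω} (hμ : μ ∈ E.beliefs) {θ : ℝ}
    (hθ : θ ∈ E.types) : ∫ ν, E.valuation ν θ ∂(σ.posteriorLaw μ) = E.gain σ μ * θ := by
  rw [gain, ← integral_mul_const]
  refine integral_congr_ae ?_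
  filter_upwards [A.ae_mem_beliefs σ hμ] with ν hν using A.valuation_eq hν hθ

theorem payoff_eq (σ : Experiment Ω S) {μ : Belief Ω} (hμ : μ ∈ E.beliefs) {θ : ℝ}
    (hθ : θ ∈ E.types) : E.payoff σ μ θ = E.gain σ μ * θ - E.cost σ μ := by
  rw [payoff, A.integral_valuation σ hμ hθ]

theorem gain_mono {σ σ' : Experiment Ω S} (h : σ'.IsGarblingOf σ) {μ : Belief Ω}
    (hμ : μ ∈ E.beliefs) : E.gain σ' μ ≤ E.gain σ μ := by
  have := A.standing.blackwell E.hi A.hi_mem μ hμ σ σ' h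
  rw [A.integral_valuation σ hμ A.hi_mem, A.integral_valuation σ' hμ A.hi_mem] at this
  exact le_of_mul_le_mul_right this A.hi_pos

theorem gain_le_full (σ : Experiment Ω S) {μ : Belief Ω} (hμ : μ ∈ E.beliefs) :
    E.gain σ μ ≤ E.gain E.full μ :=
  A.gain_mono (E.isGarblingOf_full σ) hμ

theorem gain_null (μ : Belief Ω) : E.gain E.null μ = E.unitValue μ := by
  obtain ⟨m, hm⟩ := A.standing.null_uninformative
  rw [gain, Experiment.posteriorLaw_of_const hm,
    integral_dirac' _ _ A.measurable_unitValue.stronglyMeasurable]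

theorem unitValue_le_gain (σ : Experiment Ω S) {μ : Belief Ω} (hμ : μ ∈ E.beliefs) :
    E.unitValue μ ≤ E.gain σ μ := by
  obtain ⟨m, hm⟩ := A.standing.null_uninformative
  rw [← A.gain_null μ]
  exact A.gain_mono (Experiment.isGarblingOf_of_const hm σ) hμ

theorem gain_full_eq (μ : Belief Ω) :
    E.gain E.full μ = ∫ ω, E.unitValue (diracBelief ω) ∂(beliefKernel Ω μ) := by
  rw [gain, E.posteriorLaw_full, integral_map measurable_diracBelief.aemeasurable
    A.measurable_unitValue.aestronglyMeasurable]
  rfl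

theorem integrable_unitValue_diracBelief :
    Integrable (fun ω => E.unitValue (diracBelief ω)) (E.prior : Measure Ω) := by
  have h := A.integrable_unitValue E.full A.standing.prior_mem
  rw [E.posteriorLaw_full] at h
  exact (integrable_map_measure A.measurable_unitValue.aestronglyMeasurable
    measurable_diracBelief.aemeasurable).1 h

theorem integrable_gain_full (σ : Experiment Ω S) :
    Integrable (fun μ => E.gain E.full μ) (σ.posteriorLaw E.prior) := by
  simp_rw [A.gain_full_eq]
  refine integrable_integral_of_bind ?_
  rw [σ.posteriorLaw_bind]
  exact A.integrable_unitValue_diracBelief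

/-- The value of full information is affine in the belief, so averaging it over posteriors gives its
value at the prior. -/
theorem integral_gain_full (σ : Experiment Ω S) :
    ∫ μ, E.gain E.full μ ∂(σ.posteriorLaw E.prior) = E.gain E.full E.prior := by
  have h := A.integrable_unitValue_diracBelief
  rw [← σ.posteriorLaw_bind E.prior] at h
  simp_rw [A.gain_full_eq]
  rw [← integral_bind_kernel h, σ.posteriorLaw_bind]
  rfl

end Admissible

theorem IsOptimalChoice.value_eq {σ : Experiment Ω S} {μ : Belief Ω} {θ : ℝ}
    (h : E.IsOptimalChoice σ μ θ) : E.value μ θ = E.payoff σ μ θ :=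
  IsGreatest.csSup_eq ⟨⟨σ, h.1, rfl⟩, by rintro _ ⟨τ, hτ, rfl⟩; exact h.2 τ hτ⟩

namespace Admissible

variable (A : E.Admissible)
include A

theorem payoff_le_value {σ : Experiment Ω S} (hσ : σ ∈ E.feasible) {μ : Belief Ω}
    (hμ : μ ∈ E.beliefs) {θ : ℝ} (hθ : θ ∈ E.types) : E.payoff σ μ θ ≤ E.value μ θ := by
  obtain ⟨κ, hκ⟩ := A.exists_isBestResponse hθ
  rw [(hκ.optimal μ hμ).value_eq]
  exact (hκ.optimal μ hμ).2 σ hσ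

theorem unitValue_le_value {μ : Belief Ω} (hμ : μ ∈ E.beliefs) {θ : ℝ} (hθ : θ ∈ E.types) :
    E.unitValue μ * θ ≤ E.value μ θ := by
  have := A.payoff_le_value A.standing.null_mem hμ hθ
  rwa [A.payoff_eq _ hμ hθ, A.gain_null, A.standing.cost_null μ hμ, sub_zero] at this

theorem value_le_gain_full {μ : Belief Ω} (hμ : μ ∈ E.beliefs) {θ : ℝ} (hθ : θ ∈ E.types) :
    E.value μ θ ≤ E.gain E.full μ * θ := by
  obtain ⟨κ, hκ⟩ := A.exists_isBestResponse hθ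
  rw [(hκ.optimal μ hμ).value_eq, A.payoff_eq _ hμ hθ]
  have h1 := A.standing.cost_nonneg _ (hκ.feasible μ) μ hμ
  have h2 := mul_le_mul_of_nonneg_right (A.gain_le_full (κ.choice μ) hμ) (A.type_nonneg hθ)
  linarith

end Admissible

/-! ### The agent's own learning after the broker's experiment. -/

section BestResponse

variable [StandardBorelSpace S] {κ : Plan Ω (Belief Ω) S} {θ : ℝ}

/-- The expected unit value, at the prior, of learning with `σ` and then following `κ`. -/
noncomputable def planGain (E : Environment Ω S) (κ : Plan Ω (Belief Ω) S)
    (σ : Experiment Ω S) : ℝ :=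
  ∫ μ, E.gain (κ.choice μ) μ ∂(σ.posteriorLaw E.prior)

/-- The expected cost of following `κ` after `σ`. -/
noncomputable def planCost (E : Environment Ω S) (κ : Plan Ω (Belief Ω) S)
    (σ : Experiment Ω S) : ℝ :=
  ∫ μ, E.cost (κ.choice μ) μ ∂(σ.posteriorLaw E.prior)

namespace Admissible

variable (A : E.Admissible)
include A

theorem measurable_gain_choice (κ : Plan Ω (Belief Ω) S) :
    Measurable fun μ => E.gain (κ.choice μ) μ := by
  have h := (A.measurable_unitValue.stronglyMeasurable.integral_kernel
    (κ := κ.continuation)).measurable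
  simp_rw [κ.continuation_apply] at h
  exact h

theorem integrable_gain_choice (κ : Plan Ω (Belief Ω) S) (σ : Experiment Ω S) :
    Integrable (fun μ => E.gain (κ.choice μ) μ) (σ.posteriorLaw E.prior) := by
  refine integrable_of_le_of_le (A.measurable_gain_choice κ).aestronglyMeasurable ?_ ?_
    (A.integrable_unitValue σ A.standing.prior_mem) (A.integrable_gain_full σ)
  · filter_upwards [A.ae_mem_beliefs σ A.standing.prior_mem] with μ hμ
    exact A.unitValue_le_gain _ hμ
  · filter_upwards [A.ae_mem_beliefs σ A.standing.prior_mem] with μ hμ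
    exact A.gain_le_full _ hμ

omit [StandardBorelSpace S] in
theorem value_eq_choice (hκ : E.IsBestResponse κ θ) (hθ : θ ∈ E.types) {μ : Belief Ω}
    (hμ : μ ∈ E.beliefs) :
    E.value μ θ = E.gain (κ.choice μ) μ * θ - E.cost (κ.choice μ) μ := by
  rw [(hκ.optimal μ hμ).value_eq, A.payoff_eq _ hμ hθ]

/-- The null experiment is available, so an optimal choice never costs more than the value it adds;
this dominates the cost by an integrable function. -/
theorem integrable_cost_choice (hκ : E.IsBestResponse κ θ) (hθ : θ ∈ E.types)
    (σ : Experiment Ω S) :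
    Integrable (fun μ => E.cost (κ.choice μ) μ) (σ.posteriorLaw E.prior) := by
  refine integrable_of_le_of_le hκ.measurable_cost.aestronglyMeasurable ?_ ?_
    (integrable_zero _ ℝ _)
    (((A.integrable_gain_choice κ σ).sub (A.integrable_unitValue σ A.standing.prior_mem)).mul_const
      θ)
  · filter_upwards [A.ae_mem_beliefs σ A.standing.prior_mem] with μ hμ
    exact A.standing.cost_nonneg _ (hκ.feasible μ) μ hμ
  · filter_upwards [A.ae_mem_beliefs σ A.standing.prior_mem] with μ hμ
    have h1 := A.value_eq_choice hκ hθ hμ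
    have h2 := A.unitValue_le_value hμ hθ
    simp only [Pi.sub_apply]
    linarith

theorem integrable_value (hθ : θ ∈ E.types) (σ : Experiment Ω S) :
    Integrable (fun μ => E.value μ θ) (σ.posteriorLaw E.prior) := by
  obtain ⟨κ, hκ⟩ := A.exists_isBestResponse hθ
  refine (((A.integrable_gain_choice κ σ).mul_const θ).sub
    (A.integrable_cost_choice hκ hθ σ)).congr ?_
  filter_upwards [A.ae_mem_beliefs σ A.standing.prior_mem] with μ hμ
  exact (A.value_eq_choice hκ hθ hμ).symm

theorem experimentValue_eq (hκ : E.IsBestResponse κ θ) (hθ : θ ∈ E.types) (σ : Experiment Ω S) :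
    E.experimentValue σ θ = E.planGain κ σ * θ - E.planCost κ σ := by
  rw [experimentValue, planGain, planCost, ← integral_mul_const,
    ← integral_sub ((A.integrable_gain_choice κ σ).mul_const θ) (A.integrable_cost_choice hκ hθ σ)]
  refine integral_congr_ae ?_
  filter_upwards [A.ae_mem_beliefs σ A.standing.prior_mem] with μ hμ
  exact A.value_eq_choice hκ hθ hμ

/-- Type `θ'` can imitate the continuation of type `θ`. The left side is affine in `θ'` and by
`experimentValue_eq` exact at `θ`, which is the source of the subgradient. -/
theorem le_experimentValue (hκ : E.IsBestResponse κ θ) (hθ : θ ∈ E.types) {θ' : ℝ}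
    (hθ' : θ' ∈ E.types) (σ : Experiment Ω S) :
    E.planGain κ σ * θ' - E.planCost κ σ ≤ E.experimentValue σ θ' := by
  rw [experimentValue, planGain, planCost, ← integral_mul_const,
    ← integral_sub ((A.integrable_gain_choice κ σ).mul_const θ') (A.integrable_cost_choice hκ hθ σ)]
  refine integral_mono_ae (((A.integrable_gain_choice κ σ).mul_const θ').sub
    (A.integrable_cost_choice hκ hθ σ)) (A.integrable_value hθ' σ) ?_
  filter_upwards [A.ae_mem_beliefs σ A.standing.prior_mem] with μ hμ
  have := A.payoff_le_value (hκ.feasible μ) hμ hθ'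
  rwa [A.payoff_eq _ hμ hθ'] at this

omit [StandardBorelSpace S] in
theorem planCost_nonneg (hκ : E.IsBestResponse κ θ) (σ : Experiment Ω S) :
    0 ≤ E.planCost κ σ := by
  refine integral_nonneg_of_ae ?_
  filter_upwards [A.ae_mem_beliefs σ A.standing.prior_mem] with μ hμ
  exact A.standing.cost_nonneg _ (hκ.feasible μ) μ hμ

theorem gain_le_planGain (κ : Plan Ω (Belief Ω) S) (σ : Experiment Ω S) :
    E.gain σ E.prior ≤ E.planGain κ σ := by
  refine integral_mono_ae (A.integrable_unitValue σ A.standing.prior_mem)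
    (A.integrable_gain_choice κ σ) ?_
  filter_upwards [A.ae_mem_beliefs σ A.standing.prior_mem] with μ hμ
  exact A.unitValue_le_gain _ hμ

theorem planGain_le_full (κ : Plan Ω (Belief Ω) S) (σ : Experiment Ω S) :
    E.planGain κ σ ≤ E.gain E.full E.prior := by
  rw [← A.integral_gain_full σ]
  refine integral_mono_ae (A.integrable_gain_choice κ σ) (A.integrable_gain_full σ) ?_
  filter_upwards [A.ae_mem_beliefs σ A.standing.prior_mem] with μ hμ
  exact A.gain_le_full _ hμ

theorem gain_le_experimentValue (hθ : θ ∈ E.types) (σ : Experiment Ω S) :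
    E.gain σ E.prior * θ ≤ E.experimentValue σ θ := by
  rw [gain, experimentValue, ← integral_mul_const]
  refine integral_mono_ae ((A.integrable_unitValue σ A.standing.prior_mem).mul_const θ)
    (A.integrable_value hθ σ) ?_
  filter_upwards [A.ae_mem_beliefs σ A.standing.prior_mem] with μ hμ
  exact A.unitValue_le_value hμ hθ

theorem experimentValue_le_full (hθ : θ ∈ E.types) (σ : Experiment Ω S) :
    E.experimentValue σ θ ≤ E.gain E.full E.prior * θ := by
  rw [← A.integral_gain_full σ, experimentValue, ← integral_mul_const]
  refine integral_mono_ae (A.integrable_value hθ σ) ((A.integrable_gain_full σ).mul_const θ) ?_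
  filter_upwards [A.ae_mem_beliefs σ A.standing.prior_mem] with μ hμ
  exact A.value_le_gain_full hμ hθ

theorem experimentValue_full (hθ : θ ∈ E.types) :
    E.experimentValue E.full θ = E.gain E.full E.prior * θ :=
  le_antisymm (A.experimentValue_le_full hθ _) (A.gain_le_experimentValue hθ _)

theorem measurable_planGain (κ : Plan Ω (Belief Ω) S) :
    Measurable fun σ : Experiment Ω S => E.planGain κ σ :=
  measurable_integral_posteriorLaw _ (A.measurable_gain_choice κ)

theorem measurable_experimentValue (hθ : θ ∈ E.types) :
    Measurable fun σ : Experiment Ω S => E.experimentValue σ θ := by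
  obtain ⟨κ, hκ⟩ := A.exists_isBestResponse hθ
  simp_rw [A.experimentValue_eq hκ hθ]
  exact ((A.measurable_planGain κ).mul_const θ).sub (measurable_integral_posteriorLaw _ hκ.measurable_cost)

/-- Receiving one of her own experiments and paying its cost does not improve on the agent's own
learning, because the continuation can be folded into a single feasible experiment. -/
theorem experimentValue_sub_cost_le {σ : Experiment Ω S} (hσ : σ ∈ E.feasible)
    (hθ : θ ∈ E.types) :
    E.experimentValue σ θ - E.cost σ E.prior ≤ E.value E.prior θ := by
  obtain ⟨κ, hκ⟩ := A.exists_isBestResponse hθ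
  have hprior := A.standing.prior_mem
  have hpost := σ.measurable_posteriorBelief E.prior
  obtain ⟨hmem, hcost⟩ := A.sequential σ hσ (κ.after σ E.prior)
    (fun s => hκ.feasible (σ.posteriorBelief E.prior s))
  have hint : Integrable (fun s => E.cost ((κ.after σ E.prior).choice s)
      (σ.posteriorBelief E.prior s)) (σ.signalLaw E.prior) :=
    (integrable_map_measure hκ.measurable_cost.aestronglyMeasurable hpost.aemeasurable).1
      (A.integrable_cost_choice hκ hθ σ)
  have hc := hcost E.prior hprior hint
  have e1 : ∫ s, E.cost ((κ.after σ E.prior).choice s) (σ.posteriorBelief E.prior s)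
      ∂(σ.signalLaw E.prior) = E.planCost κ σ :=
    (integral_map hpost.aemeasurable hκ.measurable_cost.aestronglyMeasurable).symm
  -- The folded experiment induces the same final beliefs as `σ` followed by `κ`.
  have e2 : E.gain (E.seq σ (κ.after σ E.prior)) E.prior = E.planGain κ σ := by
    have h := A.integrable_unitValue (E.seq σ (κ.after σ E.prior)) hprior
    rw [E.posteriorLaw_seq_after] at h
    rw [gain, E.posteriorLaw_seq_after, integral_bind_kernel h]
    simp_rw [κ.continuation_apply]
    rfl
  have hv := A.payoff_le_value hmem hprior hθ
  rw [A.payoff_eq _ hprior hθ, e2] at hv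
  rw [e1] at hc
  rw [A.experimentValue_eq hκ hθ]
  linarith

/-- An agent who receives the experiment that she would choose does not learn further. -/
theorem experimentValue_of_isOptimalChoice {σ : Experiment Ω S}
    (hσ : E.IsOptimalChoice σ E.prior θ) (hθ : θ ∈ E.types) :
    E.experimentValue σ θ = E.gain σ E.prior * θ := by
  refine le_antisymm ?_ (A.gain_le_experimentValue hθ σ)
  -- By optimality the outside option is `gain * θ - cost` of this same `σ`, so its cost cancels.
  have h1 := A.experimentValue_sub_cost_le hσ.1 hθ
  rw [hσ.value_eq, A.payoff_eq _ A.standing.prior_mem hθ] at h1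
  linarith

end Admissible

end BestResponse

end Environment

/-! ### The threshold mechanism and its optimality. -/

namespace Environment

variable {Ω S : Type*} [MeasurableSpace Ω] [StandardBorelSpace Ω] [Nonempty Ω]
  [MeasurableSpace S] {E : Environment Ω S}

/-- Envelope inequality: type `θ'` can conduct the experiment chosen by `θ`, whose cost does not
depend on the type. -/
theorem Admissible.value_add_le (A : E.Admissible) {σ : Experiment Ω S} {θ θ' : ℝ}
    (hσ : E.IsOptimalChoice σ E.prior θ) (hθ : θ ∈ E.types) (hθ' : θ' ∈ E.types) :
    E.value E.prior θ + E.gain σ E.prior * (θ' - θ) ≤ E.value E.prior θ' := by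
  have h := A.payoff_le_value hσ.1 A.standing.prior_mem hθ'
  rw [A.payoff_eq _ A.standing.prior_mem hθ'] at h
  rw [hσ.value_eq, A.payoff_eq _ A.standing.prior_mem hθ]
  linarith

theorem Admissible.value_sub_le (A : E.Admissible) {θ θ' : ℝ} (hθ : θ ∈ E.types)
    (hθ' : θ' ∈ E.types) (h : θ ≤ θ') :
    E.value E.prior θ' ≤ E.value E.prior θ + E.gain E.full E.prior * (θ' - θ) := by
  obtain ⟨κ, hκ⟩ := A.exists_isBestResponse hθ'
  have h1 := A.value_add_le (hκ.optimal _ A.standing.prior_mem) hθ' hθ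
  have h2 := mul_le_mul_of_nonneg_right
    (A.gain_le_full (κ.choice E.prior) A.standing.prior_mem) (sub_nonneg.2 h)
  linarith

/-- Full information above the monopoly type, and the experiments `s` below it. -/
noncomputable def thresholdAlloc (E : Environment Ω S) (s : ℝ → Experiment Ω S) (θ : ℝ) :
    Experiment Ω S :=
  if θ < E.monopolyType then s θ else E.full

/-- The interim utility when the outside option binds up to the monopoly type. -/
noncomputable def thresholdUtility (E : Environment Ω S) (θ : ℝ) : ℝ :=
  if θ < E.monopolyType then E.value E.prior θ
  else E.value E.prior E.monopolyType + E.gain E.full E.prior * (θ - E.monopolyType)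

/-- The slope of `thresholdUtility`. -/
noncomputable def thresholdGain (E : Environment Ω S) (s : ℝ → Experiment Ω S) (θ : ℝ) : ℝ :=
  E.gain (E.thresholdAlloc s θ) E.prior

/-- The payments that implement `thresholdAlloc` with `thresholdUtility`. -/
noncomputable def thresholdPayment (E : Environment Ω S) (s : ℝ → Experiment Ω S) (θ : ℝ) : ℝ :=
  θ * E.thresholdGain s θ - E.thresholdUtility θ

/-- The mechanism that implements `thresholdAlloc` with `thresholdUtility`. -/
noncomputable def thresholdMechanism (E : Environment Ω S) (s : ℝ → Experiment Ω S) :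
    Mechanism Ω S :=
  Mechanism.deterministic (E.thresholdAlloc s) (E.thresholdPayment s)

variable {s : ℝ → Experiment Ω S}

omit [StandardBorelSpace Ω] [Nonempty Ω] in
theorem thresholdAlloc_of_lt {θ : ℝ} (h : θ < E.monopolyType) : E.thresholdAlloc s θ = s θ :=
  if_pos h

omit [StandardBorelSpace Ω] [Nonempty Ω] in
theorem thresholdAlloc_of_le {θ : ℝ} (h : E.monopolyType ≤ θ) : E.thresholdAlloc s θ = E.full :=
  if_neg h.not_gt

theorem thresholdUtility_of_lt {θ : ℝ} (h : θ < E.monopolyType) :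
    E.thresholdUtility θ = E.value E.prior θ :=
  if_pos h

theorem thresholdUtility_of_le {θ : ℝ} (h : E.monopolyType ≤ θ) :
    E.thresholdUtility θ
      = E.value E.prior E.monopolyType + E.gain E.full E.prior * (θ - E.monopolyType) :=
  if_neg h.not_gt

theorem thresholdUtility_monopolyType :
    E.thresholdUtility E.monopolyType = E.value E.prior E.monopolyType := by
  rw [thresholdUtility_of_le le_rfl]; ring

theorem thresholdGain_of_le {θ : ℝ} (h : E.monopolyType ≤ θ) :
    E.thresholdGain s θ = E.gain E.full E.prior := by
  rw [thresholdGain, thresholdAlloc_of_le h]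

theorem Admissible.value_le_thresholdUtility (A : E.Admissible) {θ : ℝ} (hθ : θ ∈ E.types) :
    E.value E.prior θ ≤ E.thresholdUtility θ := by
  rcases lt_or_ge θ E.monopolyType with h | h
  · rw [thresholdUtility_of_lt h]
  · rw [thresholdUtility_of_le h]
    exact A.value_sub_le A.typeDensity.monopolyType_mem hθ h

/-- Below `θ*` the slopes are those of the convex outside option; continuing with the
full-information slope, the largest possible one, keeps the function convex. -/
theorem Admissible.isSubgradientOn_thresholdUtility (A : E.Admissible)
    (hs : ∀ θ ∈ Ico E.lo E.monopolyType, E.IsOptimalChoice (s θ) E.prior θ) :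
    IsSubgradientOn E.thresholdUtility (E.thresholdGain s) E.types := by
  intro x hx y hy
  rcases lt_or_ge x E.monopolyType with h | h
  · rw [thresholdUtility_of_lt h, thresholdGain, thresholdAlloc_of_lt h]
    exact (A.value_add_le (hs x ⟨hx.1, h⟩) hx hy).trans (A.value_le_thresholdUtility hy)
  · rw [thresholdUtility_of_le h, thresholdGain_of_le h]
    rcases lt_or_ge y E.monopolyType with h' | h'
    · rw [thresholdUtility_of_lt h']
      have := A.value_sub_le hy A.typeDensity.monopolyType_mem h'.le
      linarith
    · rw [thresholdUtility_of_le h']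
      linarith

section

variable [StandardBorelSpace S]

theorem Admissible.reportUtility_deterministic (A : E.Admissible) {α : ℝ → Experiment Ω S}
    {p : ℝ → ℝ} {θ : ℝ} (hθ : θ ∈ E.types) (θ' : ℝ) :
    E.reportUtility (Mechanism.deterministic α p) θ θ' = E.experimentValue (α θ') θ - p θ' := by
  have h : ∫ σ, E.experimentValue σ θ ∂(Measure.dirac (α θ')) = E.experimentValue (α θ') θ :=
    integral_dirac' _ _ (A.measurable_experimentValue hθ).stronglyMeasurable
  rw [← h]
  rfl

theorem Admissible.experimentValue_thresholdAlloc (A : E.Admissible)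
    (hs : ∀ θ ∈ Ico E.lo E.monopolyType, E.IsOptimalChoice (s θ) E.prior θ) {θ : ℝ}
    (hθ : θ ∈ E.types) :
    E.experimentValue (E.thresholdAlloc s θ) θ = θ * E.thresholdGain s θ := by
  rw [thresholdGain, mul_comm]
  rcases lt_or_ge θ E.monopolyType with h | h
  · rw [thresholdAlloc_of_lt h]
    exact A.experimentValue_of_isOptimalChoice (hs θ ⟨hθ.1, h⟩) hθ
  · rw [thresholdAlloc_of_le h]
    exact A.experimentValue_full hθ

theorem Admissible.utility_thresholdMechanism (A : E.Admissible)
    (hs : ∀ θ ∈ Ico E.lo E.monopolyType, E.IsOptimalChoice (s θ) E.prior θ) {θ : ℝ}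
    (hθ : θ ∈ E.types) : E.utility (E.thresholdMechanism s) θ = E.thresholdUtility θ := by
  rw [utility, thresholdMechanism, A.reportUtility_deterministic hθ,
    A.experimentValue_thresholdAlloc hs hθ, thresholdPayment]
  ring

/-- A report below `θ*` buys a feasible experiment at exactly its cost, which is worth no more than
the outside option. Any report above buys full information, where nothing is left to learn and
utility is linear in the type. -/
theorem Admissible.isFeasible_thresholdMechanism (A : E.Admissible)
    (hs : ∀ θ ∈ Ico E.lo E.monopolyType, E.IsOptimalChoice (s θ) E.prior θ) :
    E.IsFeasible (E.thresholdMechanism s) where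
  ic θ hθ θ' hθ' := by
    rw [A.utility_thresholdMechanism hs hθ, thresholdMechanism, A.reportUtility_deterministic hθ]
    rcases lt_or_ge θ' E.monopolyType with h | h
    · refine le_trans ?_ (A.value_le_thresholdUtility hθ)
      have hopt := hs θ' ⟨hθ'.1, h⟩
      have h1 := A.experimentValue_sub_cost_le hopt.1 hθ
      rw [thresholdPayment, thresholdGain, thresholdAlloc_of_lt h, thresholdUtility_of_lt h,
        hopt.value_eq, A.payoff_eq _ A.standing.prior_mem hθ']
      linarith
    · have h1 := A.isSubgradientOn_thresholdUtility hs θ' hθ' θ hθ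
      rw [thresholdPayment, thresholdAlloc_of_le h, A.experimentValue_full hθ]
      rw [thresholdGain_of_le h] at h1 ⊢
      linarith
  ir θ hθ := by
    rw [A.utility_thresholdMechanism hs hθ]
    exact A.value_le_thresholdUtility hθ
  payment_integrable :=
    A.typeDensity.intervalIntegrable_surplus (A.isSubgradientOn_thresholdUtility hs)

/-- Incentive compatibility as an envelope condition: the slope of the interim utility is an
expected unit value, and the payment is at most the surplus net of the interim utility. -/
theorem Admissible.exists_isSubgradientOn_utility (A : E.Admissible) {M : Mechanism Ω S}
    (hM : E.IncentiveCompatible M) :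
    ∃ a : ℝ → ℝ, IsSubgradientOn (E.utility M) a E.types ∧
      ∀ θ ∈ E.types, a θ ≤ E.gain E.full E.prior ∧
        M.payment θ ≤ θ * a θ - E.utility M θ := by
  -- Outside the type space any plan serves, so that `κ` is a total function.
  have hex : ∀ θ, ∃ κ : Plan Ω (Belief Ω) S, θ ∈ E.types → E.IsBestResponse κ θ := by
    intro θ
    by_cases hθ : θ ∈ E.types
    · obtain ⟨κ, hκ⟩ := A.exists_isBestResponse hθ
      exact ⟨κ, fun _ => hκ⟩
    · obtain ⟨κ, -⟩ := A.exists_isBestResponse A.hi_mem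
      exact ⟨κ, fun h => absurd h hθ⟩
  choose κ hκ using hex
  have hprob := M.isProbabilityMeasure_alloc
  -- Every experiment's gain at the prior lies between no and full information, so it is bounded
  -- uniformly over the allocation.
  have hgain : ∀ θ, Integrable (fun σ => E.planGain (κ θ) σ) (M.alloc θ) := fun θ =>
    integrable_of_le_of_le (A.measurable_planGain (κ θ)).aestronglyMeasurable
      (Filter.Eventually.of_forall fun σ =>
        (A.unitValue_le_gain σ A.standing.prior_mem).trans (A.gain_le_planGain (κ θ) σ))
      (Filter.Eventually.of_forall fun σ => A.planGain_le_full (κ θ) σ)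
      (integrable_const _) (integrable_const _)
  have hvalue : ∀ θ ∈ E.types, ∀ θ',
      Integrable (fun σ => E.experimentValue σ θ) (M.alloc θ') := fun θ hθ θ' =>
    integrable_of_le_of_le (A.measurable_experimentValue hθ).aestronglyMeasurable
      (Filter.Eventually.of_forall fun σ =>
        (mul_le_mul_of_nonneg_right (A.unitValue_le_gain σ A.standing.prior_mem)
          (A.type_nonneg hθ)).trans (A.gain_le_experimentValue hθ σ))
      (Filter.Eventually.of_forall fun σ => A.experimentValue_le_full hθ σ)
      (integrable_const _) (integrable_const _)
  have hcost : ∀ θ ∈ E.types, Integrable (fun σ => E.planCost (κ θ) σ) (M.alloc θ) := by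
    intro θ hθ
    refine (((hgain θ).mul_const θ).sub (hvalue θ hθ θ)).congr ?_
    refine Filter.Eventually.of_forall fun σ => ?_
    have := A.experimentValue_eq (hκ θ hθ) hθ σ
    simp only [Pi.sub_apply]
    linarith
  set a : ℝ → ℝ := fun θ => ∫ σ, E.planGain (κ θ) σ ∂(M.alloc θ)
  set c : ℝ → ℝ := fun θ => ∫ σ, E.planCost (κ θ) σ ∂(M.alloc θ)
  have hsplit : ∀ θ ∈ E.types, ∀ t : ℝ,
      ∫ σ, (E.planGain (κ θ) σ * t - E.planCost (κ θ) σ) ∂(M.alloc θ) = a θ * t - c θ := by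
    intro θ hθ t
    rw [integral_sub ((hgain θ).mul_const t) (hcost θ hθ), integral_mul_const]
  have hu : ∀ θ ∈ E.types, E.utility M θ = a θ * θ - c θ - M.payment θ := by
    intro θ hθ
    rw [← hsplit θ hθ θ]
    simp_rw [← A.experimentValue_eq (hκ θ hθ) hθ]
    rfl
  refine ⟨a, fun x hx y hy => ?_, fun θ hθ => ⟨?_, ?_⟩⟩
  · refine le_trans ?_ (hM y hy x hx)
    have hle : a x * y - c x ≤ ∫ σ, E.experimentValue σ y ∂(M.alloc x) := by
      rw [← hsplit x hx y]
      exact integral_mono (((hgain x).mul_const y).sub (hcost x hx)) (hvalue y hy x)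
        fun σ => A.le_experimentValue (hκ x hx) hx hy σ
    rw [hu x hx]
    change _ ≤ (∫ σ, E.experimentValue σ y ∂(M.alloc x)) - M.payment x
    linarith
  · calc a θ ≤ ∫ _, E.gain E.full E.prior ∂(M.alloc θ) :=
          integral_mono (hgain θ) (integrable_const _) fun σ => A.planGain_le_full (κ θ) σ
      _ = E.gain E.full E.prior := by simp
  · have h0 : 0 ≤ c θ := integral_nonneg fun σ => A.planCost_nonneg (hκ θ hθ) σ
    rw [hu θ hθ]
    linarith

theorem Admissible.isOptimal_thresholdMechanism (A : E.Admissible) (hreg : E.Regular)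
    (hs : ∀ θ ∈ Ico E.lo E.monopolyType, E.IsOptimalChoice (s θ) E.prior θ) :
    E.IsOptimal (E.thresholdMechanism s) := by
  refine ⟨A.isFeasible_thresholdMechanism hs, fun M hM => ?_⟩
  have H := A.typeDensity
  obtain ⟨a, ha, hbound⟩ := A.exists_isSubgradientOn_utility hM.ic
  calc E.revenue M ≤ ∫ θ in E.lo..E.hi, (θ * a θ - E.utility M θ) * E.density θ := by
        refine intervalIntegral.integral_mono_ae_restrict H.lo_lt_hi.le hM.payment_integrable
          (H.intervalIntegrable_surplus ha) ?_
        rw [Filter.EventuallyLE, ae_restrict_iff' measurableSet_Icc]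
        filter_upwards [H.density_nonneg_ae] with θ h hθ
        exact mul_le_mul_of_nonneg_right (hbound θ hθ).2 (h hθ)
    -- Individual rationality enters only up to `θ*`; above it the bound on slopes suffices.
    _ ≤ ∫ θ in E.lo..E.hi, (θ * E.thresholdGain s θ - E.thresholdUtility θ) * E.density θ := by
        refine H.integral_surplus_le hreg ha (A.isSubgradientOn_thresholdUtility hs) ?_ ?_
        · intro θ hθ
          have hθ' : θ ∈ E.types := ⟨hθ.1, hθ.2.trans H.monopolyType_lt_hi.le⟩
          refine le_trans (le_of_eq ?_) (hM.ir θ hθ')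
          rcases hθ.2.eq_or_lt with rfl | h
          · exact thresholdUtility_monopolyType
          · exact thresholdUtility_of_lt h
        · intro θ hθ
          rw [thresholdGain_of_le hθ.1.le]
          exact (hbound θ ⟨H.lo_le_monopolyType.trans hθ.1.le, hθ.2.le⟩).1
    _ = E.revenue (E.thresholdMechanism s) := rfl

end

end Environment

end InfoSale

theorem theorem2 {Ω S : Type*} [MeasurableSpace Ω] [StandardBorelSpace Ω] [Nonempty Ω]
    [MeasurableSpace S] [StandardBorelSpace S]
    (E : InfoSale.Environment Ω S) (hstanding : E.Standing) (hwell : E.WellPosed)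
    (htypes : E.HasTypeDensity) (hconvex : E.ConvexSeparable)
    (hseq : E.SequentialLearning) (hregular : E.Regular)
    -- the agent's own optimal experiments at the prior, with ties broken by maximizing the cost
    (s : ℝ → InfoSale.Experiment Ω S)
    (hs : ∀ θ ∈ Ico E.lo E.monopolyType, E.IsTieBrokenChoice (s θ) E.prior θ) :
    ∃ (α : ℝ → InfoSale.Experiment Ω S) (p : ℝ → ℝ),
      E.IsOptimal (InfoSale.Mechanism.deterministic α p) ∧
      (∀ θ ∈ Icc E.monopolyType E.hi, α θ = E.full) ∧
      (∀ θ ∈ Ico E.lo E.monopolyType, α θ = s θ) ∧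
      E.utility (InfoSale.Mechanism.deterministic α p) E.lo = E.value E.prior E.lo ∧
      ∀ θ ∈ Ico E.lo E.monopolyType,
        E.utility (InfoSale.Mechanism.deterministic α p) θ = E.value E.prior θ := by
  have A : E.Admissible := ⟨hstanding, hwell, htypes, hconvex, hseq⟩
  have hopt : ∀ θ ∈ Ico E.lo E.monopolyType, E.IsOptimalChoice (s θ) E.prior θ :=
    fun θ hθ => (hs θ hθ).1
  have hlo : E.lo ∈ E.types := left_mem_Icc.2 htypes.lo_lt_hi.le
  refine ⟨E.thresholdAlloc s, E.thresholdPayment s, A.isOptimal_thresholdMechanism hregular hopt,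
    fun θ hθ => InfoSale.Environment.thresholdAlloc_of_le hθ.1,
    fun θ hθ => InfoSale.Environment.thresholdAlloc_of_lt hθ.2, ?_, fun θ hθ => ?_⟩
  · refine (A.utility_thresholdMechanism hopt hlo).trans ?_
    rcases htypes.lo_le_monopolyType.eq_or_lt with h | h
    · rw [h]
      exact InfoSale.Environment.thresholdUtility_monopolyType
    · exact InfoSale.Environment.thresholdUtility_of_lt h
  · exact (A.utility_thresholdMechanism hopt
      ⟨hθ.1, hθ.2.le.trans htypes.monopolyType_lt_hi.le⟩).trans
      (InfoSale.Environment.thresholdUtility_of_lt hθ.2)
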